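/- Let $\delta\in(-1,1)$, $F_1=\mathrm{diag}(1,1+\delta)$, $F_2=\mathrm{diag}(1,1-\delta)$ and $K=SO(2)F_1\cup SO(2)F_2\subset\mathbb R^{2\times 2}$. Let $\Omega\subset\mathbb R^2$ be a nonempty bounded open set. For $F\in\mathbb R^{2\times2}$ let $\mathcal A_F$ be the set of all $y\in W^{1,\infty}(\Omega;\mathbb R^2)$ with $y=Fx$ on $\partial\Omega$, i.e. $y$ has a representative that is continuous on $\overline\Omega$ and equal to $Fx$ on $\partial\Omega$. (0) If $\delta\neq0$, there is only one rank-one connection in $K$ up to a common rotation: for $Q\in SO(2)$, $\mathrm{rank}(QF_1-F_2)=1$ if and only if $Q=\mathrm{Id}$, while $\mathrm{rank}(QF_i-F_i)\ne1$ for $i=1,2$. (1) Let $F\in\mathbb R^{2\times2}$, let $y^j\in\mathcal A_F$ converge weakly-* in $W^{1,\infty}(\Omega;\mathbb R^2)$ to $y$, and suppose that $(\nabla y^j)_j$ generates the gradient Young measure $(\nu_x)_{x\in\Omega}$, that is, $(\nu_x)$ is a weakly-* measurable family of probability measures on $\mathbb R^{2\times2}$ and $f(\nabla y^j)\rightharpoonup^*\int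 f\,d\nu_x$ in $L^\infty(\Omega)$ for every $f\in C_0(\mathbb R^{2\times2})$. If $\operatorname{supp}\nu_x\subset K$ for a.e. $x\in\Omega$, then there exist $Q\in SO(2)$ and $\lambda\in[0,1]$, independent of $x$, such that $$\nu_x=\lambda\,\delta_{QF_1}+(1-\lambda)\,\delta_{QF_2}\quad\text{for a.e. }x\in\Omega,\qquad F=\lambda QF_1+(1-\lambda)QF_2 .$$ This representation is unique: if also $\nu_x=\lambda'\delta_{Q'F_1}+(1-\lambda')\delta_{Q'F_2}$ for a.e. $x\in\Omega$ with $Q'\in SO(2)$ and $\lambda'\in[0,1]$, then $Q'=Q$, and $\lambda'=\lambda$ provided $\delta\ne0$. (2) In particular, there are no convex integration solutions for $K$ with affine boundary data: if $F\in\mathbb R^{2\times2}$, $u\in\mathcal A_F$ and $\nabla u\in K$ a.e. in $\Omega$, then $F\in K$ and $u(x)=Fx$ for a.e. $x\in\Omega$. -/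

import Mathlib

open MeasureTheory Filter Topology Set
open scoped Matrix ENNReal ContDiff ZeroAtInfty

/-- The Euclidean plane. -/
abbrev Plane : Type := EuclideanSpace ℝ (Fin 2)

/-- Real `2 × 2` matrices. -/
abbrev Mat2 : Type := Matrix (Fin 2) (Fin 2) ℝ

/-- Matrices carry the Borel `σ`-algebra. -/
instance : MeasurableSpace Mat2 := borel Mat2

instance : BorelSpace Mat2 := ⟨rfl⟩

/-- The rotation group `SO(2)`. -/
abbrev SO2 : Submonoid Mat2 := Matrix.specialOrthogonalGroup (Fin 2) ℝ

/-- `F₁ = diag(1, 1 + δ)`. -/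
def wellOne (δ : ℝ) : Mat2 := !![1, 0; 0, 1 + δ]

/-- `F₂ = diag(1, 1 - δ)`. -/
def wellTwo (δ : ℝ) : Mat2 := !![1, 0; 0, 1 - δ]

/-- `K = SO(2) F₁ ∪ SO(2) F₂`. -/
def twoWell (δ : ℝ) : Set Mat2 :=
  {A | ∃ Q ∈ SO2, A = Q * wellOne δ} ∪ {A | ∃ Q ∈ SO2, A = Q * wellTwo δ}

/-- `G` is the distributional gradient of `y` on `Ω`: `∫_Ω yᵢ ∂ₖφ = - ∫_Ω Gᵢₖ φ` for all
`φ ∈ C_c^∞(Ω)`. -/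
def IsWeakGradient (Ω : Set Plane) (y : Plane → Plane) (G : Plane → Mat2) : Prop :=
  ∀ φ : Plane → ℝ, ContDiff ℝ ∞ φ → HasCompactSupport φ → tsupport φ ⊆ Ω →
    ∀ i k : Fin 2,
      ∫ x in Ω, y x i * fderiv ℝ φ x (EuclideanSpace.single k 1) = - ∫ x in Ω, G x i k * φ x

/-- `y ∈ W^{1,∞}(Ω; ℝ²)` with weak gradient `G`. -/
structure MemW1Infty (Ω : Set Plane) (y : Plane → Plane) (G : Plane → Mat2) : Prop where
  memLp : ∀ i, MemLp (fun x => y x i) ∞ (volume.restrict Ω)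
  memLp_grad : ∀ i k, MemLp (fun x => G x i k) ∞ (volume.restrict Ω)
  weakGradient : IsWeakGradient Ω y G

/-- `y = F x` on `∂Ω`: the representative of `y` which is continuous on the closure of `Ω`
has the boundary values `F x`. -/
def HasAffineBoundaryValues (Ω : Set Plane) (F : Mat2) (y : Plane → Plane) : Prop :=
  ∃ v : Plane → Plane, ContinuousOn v (closure Ω) ∧ (∀ᵐ x ∂volume.restrict Ω, v x = y x) ∧
    ∀ x ∈ frontier Ω, v x = WithLp.toLp 2 (F *ᵥ x.ofLp)

/-- Weak-* convergence in `L^∞(Ω) = (L¹(Ω))'`. -/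
def WeakStarTendsto (Ω : Set Plane) (g : ℕ → Plane → ℝ) (h : Plane → ℝ) : Prop :=
  ∀ φ : Plane → ℝ, Integrable φ (volume.restrict Ω) →
    Tendsto (fun j => ∫ x in Ω, φ x * g j x) atTop (𝓝 (∫ x in Ω, φ x * h x))

/-- Weak-* convergence `yʲ ⇀ y` in `W^{1,∞}(Ω; ℝ²)`, where `Gʲ`, `G` are the gradients of
`yʲ`, `y`. The uniform bound is automatic for a weak-* convergent sequence (uniform boundedness
principle) and is recorded for convenience. -/
structure WeakStarTendstoW1Infty (Ω : Set Plane) (yj : ℕ → Plane → Plane) (Gj : ℕ → Plane → Mat2)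
    (y : Plane → Plane) (G : Plane → Mat2) : Prop where
  bounded : ∃ C : ℝ, ∀ j, ∀ᵐ x ∂volume.restrict Ω,
    (∀ i, |yj j x i| ≤ C) ∧ ∀ i k, |Gj j x i k| ≤ C
  tendsto : ∀ i, WeakStarTendsto Ω (fun j x => yj j x i) (fun x => y x i)
  tendsto_grad : ∀ i k, WeakStarTendsto Ω (fun j x => Gj j x i k) (fun x => G x i k)

/-- The (weak-* measurable, probability valued) family `(ν_x)` is the Young measure generated by
the sequence `(Gʲ)` on `Ω`: for all `f ∈ C₀(ℝ^{2×2})`, `f(Gʲ) ⇀ ⟨ν_x, f⟩` weakly-* in `L^∞(Ω)`. -/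
structure GeneratesYoungMeasure (Ω : Set Plane) (Gj : ℕ → Plane → Mat2)
    (ν : Plane → Measure Mat2) : Prop where
  isProbabilityMeasure : ∀ᵐ x ∂volume.restrict Ω, IsProbabilityMeasure (ν x)
  aemeasurable : ∀ f : C₀(Mat2, ℝ), AEMeasurable (fun x => ∫ A, f A ∂ν x) (volume.restrict Ω)
  tendsto : ∀ f : C₀(Mat2, ℝ),
    WeakStarTendsto Ω (fun j x => f (Gj j x)) (fun x => ∫ A, f A ∂ν x)

/-- The simple laminate `t δ_{Q F₁} + (1 - t) δ_{Q F₂}`. -/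
noncomputable def simpleLaminate (δ : ℝ) (Q : Mat2) (t : ℝ) : Measure Mat2 :=
  ENNReal.ofReal t • Measure.dirac (Q * wellOne δ) +
    ENNReal.ofReal (1 - t) • Measure.dirac (Q * wellTwo δ)

/-!
The first column of every matrix in the wells is a unit vector, and the second column is the first
one turned by a right angle and stretched by `1 ± δ`, which is also the determinant. Hence on the
wells, for a fixed vector `p`, both `|A e₁ - p|²` and `det A * |A e₁ - p|²` coincide with affine
combinations of `1`, the entries of `A` and `det A`. The integrals of such null Lagrangians of
gradients over `Ω` depend only on the affine boundary values `F x`, so the Young measure satisfies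
Jensen's inequality for them with equality (`nullLagrangian_nonneg_and_ae_eq_zero`). Taking
`p = F e₁`, the nonnegativity of the two expressions gives `|F e₁| ≤ 1` and, since `det F > 0`,
`|F e₁| ≥ 1`. So `|F e₁| = 1`, and then `A e₁ = F e₁` for `ν_x`-almost every `A`
(`first_column_rigidity`). This fixes the rotation `Q`, and `ν_x` is a convex combination of the Dirac
masses at `Q F₁` and `Q F₂`, with a weight depending on `x`.

The barycenters of `ν_x` are the gradients of the weak limit `y`, so `∂₁ (y - F x) = 0`. The extension
of `y - F x` by zero has compact support and is constant along horizontal lines, so it vanishes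
(`ae_eq_zero_of_setIntegral_mul_fderiv_eq_zero`). Therefore the barycenter of `ν_x` is `F`, and the weight
does not depend on `x` (`twoWell_rigidity`). Exact solutions are constant sequences, whose Young
measure is the Dirac mass at the gradient.

The open set `Ω` is arbitrary, so the integral identities for null Lagrangians need an argument at
the boundary: the extension of `y - F x` by zero is globally Lipschitz
(`exists_isZeroExtension`), its gradient vanishes almost everywhere off `Ω`, and Lipschitz functions
may be integrated by parts on the whole plane.
-/

/-! ### Lipschitz functions -/

/-- One-sided form of the passage from local to global Lipschitz bounds: along the segment from `a`
to `b`, the function `w` can only exceed `max (w a) 0 + L t` at a point where it is positive, hence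
in `Ω`, where its growth is controlled. -/
theorem le_max_add_of_local_growth {E : Type*} [NormedAddCommGroup E] [NormedSpace ℝ E]
    {Ω : Set E} {w : E → ℝ} (hw : Continuous w) (h0 : ∀ x ∉ Ω, w x = 0) {L : ℝ} (hL : 0 ≤ L)
    (hloc : ∀ x ∈ Ω, ∀ᶠ z in 𝓝 x, w z ≤ w x + L * ‖z - x‖) (a b : E) :
    w b ≤ max (w a) 0 + L * ‖b - a‖ := by
  refine le_of_forall_pos_le_add fun η hη => ?_
  set γ : ℝ → E := fun t => a + t • (b - a) with hγ
  have hγc : Continuous γ := by fun_prop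
  set B : ℝ → ℝ := fun t => max (w a) 0 + η + L * ‖b - a‖ * t with hB
  have hBc : Continuous B := by fun_prop
  have hsub : Icc (0 : ℝ) 1 ⊆ {t | w (γ t) ≤ B t} := by
    refine IsClosed.Icc_subset_of_forall_exists_gt ?_ ?_ ?_
    · exact (isClosed_le (hw.comp hγc) hBc).inter isClosed_Icc
    · have : w a ≤ max (w a) 0 := le_max_left _ _
      simp only [mem_ofPred_eq, hγ, hB, zero_smul, add_zero, mul_zero]
      linarith
    · rintro t ⟨ht, ht0, -⟩ y hy
      have hy' : t < y := hy
      have hgood : ∀ᶠ z in 𝓝[>] t, w (γ z) ≤ B z := by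
        rcases lt_or_eq_of_le (show w (γ t) ≤ B t from ht) with hlt | heq
        · have := (hw.comp hγc).continuousAt.eventually_lt hBc.continuousAt hlt
          exact (this.filter_mono nhdsWithin_le_nhds).mono fun z hz => le_of_lt hz
        · have hpos : 0 < w (γ t) := by
            rw [heq]
            have : 0 ≤ L * ‖b - a‖ * t := by positivity
            have : 0 ≤ max (w a) 0 := le_max_right _ _
            simp only [hB]
            linarith
          have hmem : γ t ∈ Ω := by
            by_contra h
            exact hpos.ne' (h0 _ h)
          have h1 := (hγc.tendsto t).eventually (hloc _ hmem)
          filter_upwards [h1.filter_mono nhdsWithin_le_nhds, self_mem_nhdsWithin] with z hz hzt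
          have hzt' : t < z := hzt
          have h2 : γ z - γ t = (z - t) • (b - a) := by simp only [hγ]; module
          rw [h2, norm_smul, Real.norm_of_nonneg (by linarith), heq] at hz
          refine hz.trans (le_of_eq ?_)
          simp only [hB]
          ring
      obtain ⟨z, hz, hz1, hz2⟩ :=
        (hgood.and (Ioc_mem_nhdsGT hy')).exists
      exact ⟨z, hz, hz1, hz2⟩
  have := hsub (right_mem_Icc.2 zero_le_one)
  simp only [mem_ofPred_eq, hγ, hB, one_smul, mul_one, add_sub_cancel] at this
  linarith

/-- A continuous function which vanishes off `Ω` and satisfies a Lipschitz bound at each point of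
`Ω` is globally Lipschitz, without any regularity of `Ω`. -/
theorem exists_lipschitzWith_of_local {E : Type*} [NormedAddCommGroup E] [NormedSpace ℝ E]
    {Ω : Set E} {w : E → ℝ} (hw : Continuous w) (h0 : ∀ x ∉ Ω, w x = 0) {L : ℝ} (hL : 0 ≤ L)
    (hloc : ∀ x ∈ Ω, ∀ᶠ z in 𝓝 x, |w z - w x| ≤ L * ‖z - x‖) :
    ∃ C, LipschitzWith C w := by
  have hp := le_max_add_of_local_growth hw h0 hL
    fun x hx => (hloc x hx).mono fun z hz => by linarith [le_abs_self (w z - w x)]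
  have hm := le_max_add_of_local_growth (w := fun x => - w x) hw.neg (by simpa using h0) hL
    fun x hx => (hloc x hx).mono fun z hz => by linarith [neg_abs_le (w z - w x)]
  refine ⟨Real.toNNReal (2 * L), LipschitzWith.of_le_add_mul _ fun x y => ?_⟩
  rw [Real.coe_toNNReal _ (by positivity), dist_eq_norm]
  have h1 := hp y x
  have h2 := hm x y
  have h3 : 0 ≤ L * ‖x - y‖ := by positivity
  rw [norm_sub_rev y x] at h2
  rcases max_cases (w y) 0 with ⟨e, _⟩ | ⟨e, _⟩ <;>
  rcases max_cases (-w x) 0 with ⟨e', _⟩ | ⟨e', _⟩ <;> rw [e] at h1 <;> rw [e'] at h2 <;> linarith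

section LineDeriv

variable {E : Type*} [NormedAddCommGroup E] [NormedSpace ℝ E] [MeasurableSpace E] [BorelSpace E]
  [FiniteDimensional ℝ E] (μ : Measure E) [μ.IsAddHaarMeasure]

/-- The derivative of a Lipschitz function vanishes almost everywhere on its zero set. -/
theorem LipschitzWith.ae_lineDeriv_eq_zero {C : NNReal} {f : E → ℝ} (hf : LipschitzWith C f)
    {s : Set E} (hs : MeasurableSet s) (h0 : ∀ x ∈ s, f x = 0) (v : E) :
    ∀ᵐ x ∂μ, x ∈ s → lineDeriv ℝ f x v = 0 := by
  have hd := hf.ae_differentiableAt (μ := μ)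
  have hm : MeasurableSet (s ∩ {x | DifferentiableAt ℝ f x}) :=
    hs.inter (measurableSet_of_differentiableAt ℝ f)
  have key : ∀ᵐ x ∂μ.restrict (s ∩ {x | DifferentiableAt ℝ f x}),
      ‖(fderiv ℝ f x).smulRight v - 0‖₊ ≤ 0 := by
    refine ApproximatesLinearOn.norm_fderiv_sub_le μ (f := fun x => f x • v) (A := 0) (δ := 0)
      ?_ hm (fun x => (fderiv ℝ f x).smulRight v) ?_
    · intro x hx y hy
      simp [h0 x hx.1, h0 y hy.1]
    · intro x hx
      exact (hx.2.hasFDerivAt.smul_const v).hasFDerivWithinAt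
  rw [ae_restrict_iff' hm] at key
  filter_upwards [hd, key] with x hx hk hxs
  have h1 := hk ⟨hxs, hx⟩
  simp only [sub_zero, nonpos_iff_eq_zero, nnnorm_eq_zero] at h1
  rw [hx.lineDeriv_eq_fderiv]
  have h2 := congrArg (fun T => T v) h1
  simp only [ContinuousLinearMap.smulRight_apply, zero_apply,
    smul_eq_zero] at h2
  rcases h2 with h2 | h2
  · exact h2
  · simp [h2]

theorem LipschitzWith.integral_lineDeriv_eq_zero {C : NNReal} {f : E → ℝ} (hf : LipschitzWith C f)
    (hc : HasCompactSupport f) (v : E) : ∫ x, lineDeriv ℝ f x v ∂μ = 0 := by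
  have h := (LipschitzWith.const (1 : ℝ)).integral_lineDeriv_mul_eq (μ := μ) hf hc (-v)
  simpa [lineDeriv] using h.symm

theorem LipschitzWith.integrable_lineDeriv {C : NNReal} {f : E → ℝ} (hf : LipschitzWith C f)
    (hc : HasCompactSupport f) (v : E) : Integrable (fun x => lineDeriv ℝ f x v) μ := by
  have h1 := (hf.memLp_lineDeriv (μ := μ) v).locallyIntegrable le_top
  refine (integrableOn_iff_integrable_of_support_subset fun x hx => ?_).1
    (h1.integrableOn_isCompact hc.isCompact)
  by_contra h
  have h' : f =ᶠ[𝓝 x] fun _ => 0 := notMem_tsupport_iff_eventuallyEq.1 h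
  refine hx ?_
  change lineDeriv ℝ f x v = 0
  rw [h'.lineDeriv_eq]
  simp [lineDeriv]

/-- `∫ ∂ᵥf ∂ᵤg = ∫ ∂ᵤf ∂ᵥg`: second derivatives commute in the sense of distributions. As `f` and `g`
are only Lipschitz, one derivative is replaced by a difference quotient, the other one is integrated
by parts, and the difference quotient is moved to the other factor by translation. -/
theorem LipschitzWith.integral_lineDeriv_mul_lineDeriv_comm {C D : NNReal} {f g : E → ℝ}
    (hf : LipschitzWith C f) (hg : LipschitzWith D g) (hfc : HasCompactSupport f)
    (hgc : HasCompactSupport g) (v u : E) :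
    ∫ x, lineDeriv ℝ f x v * lineDeriv ℝ g x u ∂μ =
      ∫ x, lineDeriv ℝ f x u * lineDeriv ℝ g x v ∂μ := by
  have A := hf.integral_inv_smul_sub_mul_tendsto_integral_lineDeriv_mul
    (hg.integrable_lineDeriv μ hgc u) v
  have B := hg.integral_inv_smul_sub_mul_tendsto_integral_lineDeriv_mul
    (hf.integrable_lineDeriv μ hfc u) (-v)
  have key : ∀ t : ℝ, ∫ x, (t⁻¹ • (f (x + t • v) - f x)) * lineDeriv ℝ g x u ∂μ =
      -∫ x, (t⁻¹ • (g (x + t • (-v)) - g x)) * lineDeriv ℝ f x u ∂μ := by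
    intro t
    have hft : LipschitzWith C fun x => f (x + t • v) := by
      simpa [Function.comp_def] using hf.comp (isometry_add_right (t • v)).lipschitz
    have hftc : HasCompactSupport fun x => f (x + t • v) :=
      hfc.comp_homeomorph (Homeomorph.addRight (t • v))
    have hgt : LipschitzWith D fun x => g (x + t • (-v)) := by
      simpa [Function.comp_def] using hg.comp (isometry_add_right (t • (-v))).lipschitz
    have hgtc : HasCompactSupport fun x => g (x + t • (-v)) :=
      hgc.comp_homeomorph (Homeomorph.addRight (t • (-v)))
    -- integrability of a continuous compactly supported function times a derivative
    have hint : ∀ {p q : E → ℝ} {c d : NNReal}, LipschitzWith c p → HasCompactSupport p →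
        LipschitzWith d q → Integrable (fun x => p x * lineDeriv ℝ q x u) μ := by
      intro p q c d hp hpc hq
      exact (hp.continuous.integrable_of_hasCompactSupport hpc).mul_of_top_left
        (hq.memLp_lineDeriv u)
    have S1 : ∫ x, f (x + t • v) * lineDeriv ℝ g x u ∂μ =
        -∫ x, g (x + t • (-v)) * lineDeriv ℝ f x u ∂μ := by
      have h1 := hg.integral_lineDeriv_mul_eq (μ := μ) hft hftc u
      simp only [lineDeriv_neg] at h1
      have h2 : ∀ x, lineDeriv ℝ (fun x => f (x + t • v)) x u = lineDeriv ℝ f (x + t • v) u := by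
        intro x
        simp only [lineDeriv, add_right_comm]
      simp only [h2] at h1
      rw [← integral_neg]
      calc ∫ x, f (x + t • v) * lineDeriv ℝ g x u ∂μ
          = ∫ x, -lineDeriv ℝ f (x + t • v) u * g x ∂μ := by
            rw [← h1]; simp only [mul_comm]
        _ = ∫ x, -(g (x + t • (-v)) * lineDeriv ℝ f x u) ∂μ := by
            rw [← integral_add_right_eq_self _ (t • (-v))]
            congr 1 with x
            simp only [smul_neg, neg_add_cancel_right]
            ring
    have S2 : ∫ x, f x * lineDeriv ℝ g x u ∂μ = -∫ x, g x * lineDeriv ℝ f x u ∂μ := by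
      have h1 := hg.integral_lineDeriv_mul_eq (μ := μ) hf hfc u
      simp only [lineDeriv_neg] at h1
      rw [← integral_neg]
      simp only [mul_comm (f _), h1]
      congr 1 with x
      ring
    simp only [smul_eq_mul, mul_assoc, integral_const_mul, sub_mul]
    rw [integral_sub (hint hft hftc hg) (hint hf hfc hg),
      integral_sub (hint hgt hgtc hf) (hint hg hgc hf), S1, S2]
    ring
  simp only [key] at A
  have h := tendsto_nhds_unique A B.neg
  rw [h, ← integral_neg]
  congr 1 with x
  rw [lineDeriv_neg]
  ring

end LineDeriv

/-! ### Test functions -/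

section TestFunctions

variable {E : Type*} [NormedAddCommGroup E]

theorem HasCompactSupport.comp_const_sub {g : E → ℝ} (hg : HasCompactSupport g) (p : E) :
    HasCompactSupport fun z => g (p - z) :=
  hg.comp_homeomorph (Homeomorph.subLeft p)

variable [NormedSpace ℝ E]

theorem fderiv_comp_const_sub_apply {g : E → ℝ} (hg : ContDiff ℝ ∞ g) (p z v : E) :
    fderiv ℝ (fun z => g (p - z)) z v = -fderiv ℝ g (p - z) v := by
  have h := ((hg.differentiable (by simp)).differentiableAt (x := p - z)).hasFDerivAt.comp z
    ((hasFDerivAt_id z).const_sub p)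
  have h' : fderiv ℝ (fun z => g (p - z)) z = _ := h.fderiv
  rw [h']
  simp

variable [MeasurableSpace E] [BorelSpace E] [FiniteDimensional ℝ E] (μ : Measure E)
  [μ.IsAddHaarMeasure]

theorem hasFDerivAt_integral_mul_comp_sub {f g : E → ℝ} (hf : LocallyIntegrable f μ)
    (hg : ContDiff ℝ ∞ g) (hgc : HasCompactSupport g) (p : E) :
    ∃ T : E →L[ℝ] ℝ, HasFDerivAt (fun p => ∫ z, f z * g (p - z) ∂μ) T p ∧
      ∀ v, T v = ∫ z, f z * fderiv ℝ g (p - z) v ∂μ := by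
  refine ⟨_, hgc.hasFDerivAt_convolution_right (ContinuousLinearMap.lsmul ℝ ℝ) hf
    (hg.of_le (by simp)) p, fun v => ?_⟩
  rw [convolution_precompR_apply _ hf (hgc.fderiv ℝ) (hg.continuous_fderiv (by simp))]
  rfl

/-- Integration by parts of a Lipschitz function against a test function. -/
theorem LipschitzWith.integral_mul_fderiv_eq {C : NNReal} {f φ : E → ℝ} (hf : LipschitzWith C f)
    (hφ : ContDiff ℝ ∞ φ) (hc : HasCompactSupport φ) (v : E) :
    ∫ x, f x * fderiv ℝ φ x v ∂μ = -∫ x, lineDeriv ℝ f x v * φ x ∂μ := by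
  obtain ⟨D, hD⟩ := ContDiff.lipschitzWith_of_hasCompactSupport hc hφ (by simp)
  rw [hf.integral_lineDeriv_mul_eq hD hc v, ← integral_neg]
  congr 1 with x
  rw [lineDeriv_neg,
    ((hφ.differentiable (by simp)).differentiableAt (x := x)).lineDeriv_eq_fderiv]
  ring

end TestFunctions

/-! ### Zero extension of functions with affine boundary values -/

theorem Plane.abs_clm_apply_le (T : Plane →L[ℝ] ℝ) {C : ℝ}
    (hT : ∀ k, |T (EuclideanSpace.single k 1)| ≤ C) (v : Plane) : |T v| ≤ 2 * C * ‖v‖ := by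
  have hv : v = v 0 • EuclideanSpace.single 0 1 + v 1 • EuclideanSpace.single 1 1 := by
    ext i
    fin_cases i <;> simp
  have h0 : |v 0| ≤ ‖v‖ := PiLp.norm_apply_le v 0
  have h1 : |v 1| ≤ ‖v‖ := PiLp.norm_apply_le v 1
  have hC : 0 ≤ C := (abs_nonneg _).trans (hT 0)
  have hv0 := norm_nonneg v
  conv_lhs => rw [hv]
  rw [map_add, map_smul, map_smul, smul_eq_mul, smul_eq_mul]
  calc _ ≤ |v 0| * |T (EuclideanSpace.single 0 1)| + |v 1| * |T (EuclideanSpace.single 1 1)| := by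
        rw [← abs_mul, ← abs_mul]; exact abs_add_le _ _
    _ ≤ ‖v‖ * C + ‖v‖ * C := by gcongr <;> apply hT
    _ = 2 * C * ‖v‖ := by ring

/-- A continuous function whose weak partial derivatives on `Ω` are bounded by `C` is Lipschitz near
each point of `Ω`: its mollifications have gradients given by averages of the weak derivatives. -/
theorem eventually_abs_sub_le_of_weak_deriv_bound {Ω : Set Plane} (hΩ : IsOpen Ω) {w : Plane → ℝ}
    (hw : Continuous w) {g : Fin 2 → Plane → ℝ} {C : ℝ}
    (hC : ∀ k, ∀ᵐ x ∂volume.restrict Ω, |g k x| ≤ C)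
    (hweak : ∀ φ : Plane → ℝ, ContDiff ℝ ∞ φ → HasCompactSupport φ → tsupport φ ⊆ Ω → ∀ k,
      ∫ x in Ω, w x * fderiv ℝ φ x (EuclideanSpace.single k 1) = -∫ x in Ω, g k x * φ x)
    {x : Plane} (hx : x ∈ Ω) : ∀ᶠ z in 𝓝 x, |w z - w x| ≤ 2 * C * ‖z - x‖ := by
  obtain ⟨r, hr, hball⟩ : ∃ r > 0, Metric.ball x (r + r) ⊆ Ω := by
    obtain ⟨ε, hε, h⟩ := Metric.isOpen_iff.1 hΩ x hx
    exact ⟨ε / 2, by positivity, by simpa using h⟩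
  filter_upwards [Metric.ball_mem_nhds x hr] with z hz
  have hpos : ∀ n : ℕ, (0 : ℝ) < n + 2 := fun n => by positivity
  let ρ : ℕ → ContDiffBump (0 : Plane) := fun n =>
    ⟨r / (n + 2) / 2, r / (n + 2), by have := hpos n; positivity,
      half_lt_self (div_pos hr (hpos n))⟩
  have hρr : ∀ n, (ρ n).rOut < r := fun n =>
    div_lt_self hr (by have : (0 : ℝ) ≤ n := n.cast_nonneg; linarith)
  have hρ0 : Tendsto (fun n => (ρ n).rOut) atTop (𝓝 0) :=
    Tendsto.const_div_atTop (tendsto_atTop_add_const_right _ 2 tendsto_natCast_atTop_atTop) r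
  have hlim : ∀ p, Tendsto (fun n => ∫ y, w y * (ρ n).normed volume (p - y)) atTop (𝓝 (w p)) := by
    intro p
    have h := ContDiffBump.convolution_tendsto_right_of_continuous (μ := volume) hρ0 hw p
    refine h.congr fun n => ?_
    rw [convolution_eq_swap]
    simp only [ContinuousLinearMap.lsmul_apply, smul_eq_mul, mul_comm]
  have hbound : ∀ n, |(∫ y, w y * (ρ n).normed volume (z - y)) -
      ∫ y, w y * (ρ n).normed volume (x - y)| ≤ 2 * C * ‖z - x‖ := by
    intro n
    have hs : ContDiff ℝ ∞ ((ρ n).normed volume) := (ρ n).contDiff_normed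
    have hsc : HasCompactSupport ((ρ n).normed volume) := (ρ n).hasCompactSupport_normed
    choose T hT hTv using hasFDerivAt_integral_mul_comp_sub volume
      (hw.locallyIntegrable (μ := volume)) hs hsc
    refine (convex_ball x r).norm_image_sub_le_of_norm_hasFDerivWithin_le
      (fun p _ => (hT p).hasFDerivWithinAt) (fun p hp => ?_) (Metric.mem_ball_self hr) hz
    have hC0 : 0 ≤ C := by
      have : (ae (volume.restrict Ω)).NeBot := by
        rw [ae_restrict_neBot]
        exact (hΩ.measure_pos volume ⟨x, hx⟩).ne'
      obtain ⟨y, hy⟩ := (hC 0).exists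
      exact (abs_nonneg _).trans hy
    refine ContinuousLinearMap.opNorm_le_bound _ (by positivity) fun v =>
      Plane.abs_clm_apply_le (T p) (fun k => ?_) v
    set φ : Plane → ℝ := fun y => (ρ n).normed volume (p - y) with hφdef
    have hφ : ContDiff ℝ ∞ φ := hs.comp (contDiff_const.sub contDiff_id)
    have hφc : HasCompactSupport φ := hsc.comp_const_sub p
    have hsupp : tsupport φ ⊆ Ω := by
      intro y hy
      have h1 : p - y ∈ tsupport ((ρ n).normed volume) :=
        tsupport_comp_subset_preimage _ (f := fun y => p - y) (by fun_prop) hy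
      rw [(ρ n).tsupport_normed_eq, mem_closedBall_zero_iff] at h1
      apply hball
      rw [Metric.mem_ball, dist_eq_norm]
      rw [Metric.mem_ball, dist_eq_norm] at hp
      calc ‖y - x‖ = ‖(p - x) - (p - y)‖ := by congr 1; abel
        _ ≤ ‖p - x‖ + ‖p - y‖ := norm_sub_le _ _
        _ < r + r := by linarith [hρr n]
    have hval : T p (EuclideanSpace.single k 1) = ∫ y in Ω, g k y * φ y := by
      rw [hTv, ← neg_eq_iff_eq_neg.2 (hweak φ hφ hφc hsupp k), ← integral_neg,
        setIntegral_eq_integral_of_forall_compl_eq_zero]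
      · congr 1 with y
        rw [hφdef, fderiv_comp_const_sub_apply hs]
        ring
      · intro y hy
        have : fderiv ℝ φ y = 0 :=
          image_eq_zero_of_notMem_tsupport fun h => hy (hsupp (tsupport_fderiv_subset ℝ h))
        simp [this]
    rw [hval]
    have hφ0 : ∀ y, 0 ≤ φ y := fun y => (ρ n).nonneg_normed _
    have hφi : Integrable φ := hφ.continuous.integrable_of_hasCompactSupport hφc
    calc |∫ y in Ω, g k y * φ y| ≤ ∫ y in Ω, C * φ y := by
          rw [← Real.norm_eq_abs]
          refine norm_integral_le_of_norm_le (hφi.restrict.const_mul C) ?_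
          filter_upwards [hC k] with y hy
          rw [norm_mul, Real.norm_of_nonneg (hφ0 y)]
          exact mul_le_mul_of_nonneg_right hy (hφ0 y)
      _ = C * ∫ y in Ω, φ y := integral_const_mul _ _
      _ ≤ C * 1 := by
          refine mul_le_mul_of_nonneg_left ?_ hC0
          calc ∫ y in Ω, φ y ≤ ∫ y, φ y :=
                setIntegral_le_integral hφi (.of_forall hφ0)
            _ = 1 := by
                exact (integral_sub_left_eq_self ((ρ n).normed volume) volume p).trans
                  (ρ n).integral_normed
      _ = C := mul_one C
  exact le_of_tendsto (((hlim z).sub (hlim x)).abs) (.of_forall hbound)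

/-- `W` is the extension by zero of `y - F x` from `Ω` to the plane; it is Lipschitz, and
`G` is the gradient of `y` on `Ω`. -/
structure IsZeroExtension (Ω : Set Plane) (F : Mat2) (y : Plane → Plane) (G : Plane → Mat2)
    (W : Fin 2 → Plane → ℝ) : Prop where
  lipschitz : ∀ i, ∃ C, LipschitzWith C (W i)
  hasCompactSupport : ∀ i, HasCompactSupport (W i)
  eq_zero : ∀ i, ∀ x ∉ Ω, W i x = 0
  ae_eq : ∀ i, ∀ᵐ x ∂volume.restrict Ω, W i x = y x i - (F *ᵥ x.ofLp) i
  ae_lineDeriv_eq : ∀ i k, ∀ᵐ x ∂volume.restrict Ω,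
    lineDeriv ℝ (W i) x (EuclideanSpace.single k 1) = G x i k - F i k

theorem Plane.setIntegral_mulVec_mul_fderiv {Ω : Set Plane} (F : Mat2) {φ : Plane → ℝ}
    (hφ : ContDiff ℝ ∞ φ) (hc : HasCompactSupport φ) (hs : tsupport φ ⊆ Ω) (i k : Fin 2) :
    ∫ x in Ω, (F *ᵥ x.ofLp) i * fderiv ℝ φ x (EuclideanSpace.single k 1) =
      -∫ x in Ω, F i k * φ x := by
  let ℓ : Plane →L[ℝ] ℝ := LinearMap.toContinuousLinearMap
    (LinearMap.proj i ∘ₗ Matrix.mulVecLin F ∘ₗ (WithLp.linearEquiv 2 ℝ (Fin 2 → ℝ)).toLinearMap)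
  have hℓ : ∀ x : Plane, ℓ x = (F *ᵥ x.ofLp) i := fun x => rfl
  have h := ℓ.lipschitz.integral_mul_fderiv_eq volume hφ hc (EuclideanSpace.single k 1)
  have hd : ∀ x, lineDeriv ℝ ℓ x (EuclideanSpace.single k 1) = F i k := by
    intro x
    rw [ℓ.differentiableAt.lineDeriv_eq_fderiv, ContinuousLinearMap.fderiv, hℓ]
    simp
  simp only [hd, hℓ] at h
  rw [setIntegral_eq_integral_of_forall_compl_eq_zero,
    setIntegral_eq_integral_of_forall_compl_eq_zero, h]
  · intro x hx
    rw [image_eq_zero_of_notMem_tsupport fun h => hx (hs h), mul_zero]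
  · intro x hx
    have : fderiv ℝ φ x = 0 :=
      image_eq_zero_of_notMem_tsupport fun h => hx (hs (tsupport_fderiv_subset ℝ h))
    simp [this]

theorem integrable_of_memLp_top {Ω : Set Plane} (hb : Bornology.IsBounded Ω) {f : Plane → ℝ}
    (hf : MemLp f ∞ (volume.restrict Ω)) : Integrable f (volume.restrict Ω) := by
  have : IsFiniteMeasure (volume.restrict Ω) :=
    ⟨by rw [Measure.restrict_apply_univ]; exact hb.measure_lt_top⟩
  exact hf.integrable le_top

theorem Plane.memLp_mulVec {Ω : Set Plane} (hΩ : IsOpen Ω) (hb : Bornology.IsBounded Ω) (F : Mat2)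
    (i : Fin 2) : MemLp (fun x : Plane => (F *ᵥ x.ofLp) i) ∞ (volume.restrict Ω) := by
  have hc : Continuous fun x : Plane => (F *ᵥ x.ofLp) i := by
    simp only [Matrix.mulVec, dotProduct, Fin.sum_univ_two]
    fun_prop
  obtain ⟨C, hC⟩ := (hb.isCompact_closure.image hc).isBounded.exists_norm_le
  refine memLp_top_of_bound hc.aestronglyMeasurable C ?_
  filter_upwards [ae_restrict_mem hΩ.measurableSet] with x hx
  exact hC _ ⟨x, subset_closure hx, rfl⟩

theorem exists_bound_of_memLp_top {α : Type*} [MeasurableSpace α] {μ : Measure α} {f : α → ℝ}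
    (hf : MemLp f ∞ μ) : ∃ C : ℝ, ∀ᵐ x ∂μ, |f x| ≤ C := by
  refine ⟨(eLpNorm f ∞ μ).toReal, ?_⟩
  have h := ae_le_eLpNormEssSup (f := f) (μ := μ)
  filter_upwards [h] with x hx
  rw [← eLpNorm_exponent_top] at hx
  have := ENNReal.toReal_mono hf.2.ne hx
  simpa using this

theorem ae_eq_of_forall_setIntegral_mul_eq {Ω : Set Plane} (hΩ : IsOpen Ω) {f g : Plane → ℝ}
    (hf : Integrable f (volume.restrict Ω)) (hg : Integrable g (volume.restrict Ω))
    (h : ∀ φ : Plane → ℝ, ContDiff ℝ ∞ φ → HasCompactSupport φ → tsupport φ ⊆ Ω →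
      ∫ x in Ω, f x * φ x = ∫ x in Ω, g x * φ x) :
    ∀ᵐ x ∂volume.restrict Ω, f x = g x := by
  have hi : IntegrableOn (fun x => f x - g x) Ω := hf.sub hg
  have key := hΩ.ae_eq_zero_of_integral_contDiff_smul_eq_zero (μ := volume)
    hi.locallyIntegrableOn fun φ hφ hc hs => by
      rw [← setIntegral_eq_integral_of_forall_compl_eq_zero (s := Ω)]
      · obtain ⟨C, hC⟩ := hφ.continuous.bounded_above_of_compact_support hc
        have hφm : AEStronglyMeasurable φ (volume.restrict Ω) := hφ.continuous.aestronglyMeasurable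
        have h1 := hf.mul_bdd hφm (.of_forall hC)
        have h2 := hg.mul_bdd hφm (.of_forall hC)
        calc ∫ x in Ω, φ x • (f x - g x) = ∫ x in Ω, (f x * φ x - g x * φ x) := by
              congr 1 with x; simp only [smul_eq_mul]; ring
          _ = 0 := by rw [integral_sub h1 h2, h φ hφ hc hs, sub_self]
      · intro x hx
        rw [image_eq_zero_of_notMem_tsupport fun h => hx (hs h), zero_smul]
  rw [ae_restrict_iff' hΩ.measurableSet]
  filter_upwards [key] with x hx hxΩ
  exact sub_eq_zero.1 (hx hxΩ)

/-- For a `W^{1,∞}` function `y` with affine boundary values `F x` on an arbitrary bounded open set, the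
extension of `y - F x` by zero is Lipschitz. -/
theorem exists_isZeroExtension {Ω : Set Plane} (hΩ : IsOpen Ω) (hb : Bornology.IsBounded Ω)
    {F : Mat2} {y : Plane → Plane} {G : Plane → Mat2} (hy : MemW1Infty Ω y G)
    (hF : HasAffineBoundaryValues Ω F y) : ∃ W, IsZeroExtension Ω F y G W := by
  obtain ⟨v, hvc, hvy, hvF⟩ := hF
  let W : Fin 2 → Plane → ℝ := fun i => Ω.indicator fun x => v x i - (F *ᵥ x.ofLp) i
  have hWc : ∀ i, Continuous (W i) := by
    intro i
    refine continuous_indicator (fun x hx => ?_) ?_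
    · simp [hvF x hx]
    · refine ContinuousOn.sub ?_ ?_
      · exact (PiLp.continuous_apply 2 _ i).comp_continuousOn hvc
      · refine Continuous.continuousOn ?_
        simp only [Matrix.mulVec, dotProduct, Fin.sum_univ_two]
        fun_prop
  have hW0 : ∀ i, ∀ x ∉ Ω, W i x = 0 := fun i x hx => indicator_of_notMem hx _
  have hWy : ∀ i, ∀ᵐ x ∂volume.restrict Ω, W i x = y x i - (F *ᵥ x.ofLp) i := by
    intro i
    filter_upwards [hvy, ae_restrict_mem hΩ.measurableSet] with x hx hxΩ
    simp only [W, indicator_of_mem hxΩ, hx]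
  have hWcs : ∀ i, HasCompactSupport (W i) := fun i =>
    HasCompactSupport.intro hb.isCompact_closure fun x hx => hW0 i x fun h => hx (subset_closure h)
  have hGi : ∀ i k, Integrable (fun x => G x i k - F i k) (volume.restrict Ω) := fun i k =>
    (integrable_of_memLp_top hb (hy.memLp_grad i k)).sub
      (integrable_of_memLp_top hb (memLp_top_const _))
  have hweak : ∀ i, ∀ φ : Plane → ℝ, ContDiff ℝ ∞ φ → HasCompactSupport φ → tsupport φ ⊆ Ω → ∀ k,
      ∫ x in Ω, W i x * fderiv ℝ φ x (EuclideanSpace.single k 1) =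
        -∫ x in Ω, (G x i k - F i k) * φ x := by
    intro i φ hφ hc hs k
    obtain ⟨C, hC⟩ := hφ.continuous.bounded_above_of_compact_support hc
    have hd : Continuous fun x => fderiv ℝ φ x (EuclideanSpace.single k 1) :=
      (hφ.continuous_fderiv (by simp)).clm_apply continuous_const
    obtain ⟨D, hD⟩ := hd.bounded_above_of_compact_support (hc.fderiv_apply ℝ _)
    have hφm : AEStronglyMeasurable φ (volume.restrict Ω) := hφ.continuous.aestronglyMeasurable
    have hdm := hd.aestronglyMeasurable (μ := volume.restrict Ω)
    have i1 := (integrable_of_memLp_top hb (hy.memLp i)).mul_bdd hdm (.of_forall hD)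
    have i2 := (integrable_of_memLp_top hb (Plane.memLp_mulVec hΩ hb F i)).mul_bdd hdm
      (.of_forall hD)
    have i3 := (integrable_of_memLp_top hb (hy.memLp_grad i k)).mul_bdd hφm (.of_forall hC)
    have i4 : Integrable (fun x => F i k * φ x) (volume.restrict Ω) :=
      (integrable_of_memLp_top hb (memLp_top_const (F i k))).mul_bdd hφm (.of_forall hC)
    calc ∫ x in Ω, W i x * fderiv ℝ φ x (EuclideanSpace.single k 1)
        = ∫ x in Ω, (y x i * fderiv ℝ φ x (EuclideanSpace.single k 1) -
            (F *ᵥ x.ofLp) i * fderiv ℝ φ x (EuclideanSpace.single k 1)) := by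
          refine integral_congr_ae ?_
          filter_upwards [hWy i] with x hx
          rw [hx, sub_mul]
      _ = -∫ x in Ω, (G x i k * φ x - F i k * φ x) := by
          rw [integral_sub i1 i2, integral_sub i3 i4, hy.weakGradient φ hφ hc hs i k,
            Plane.setIntegral_mulVec_mul_fderiv F hφ hc hs]
          ring
      _ = _ := by simp only [sub_mul]
  have hlip : ∀ i, ∃ C, LipschitzWith C (W i) := by
    intro i
    have hbd : ∀ k, ∃ C : ℝ, ∀ᵐ x ∂volume.restrict Ω, |G x i k - F i k| ≤ C := fun k =>
      exists_bound_of_memLp_top ((hy.memLp_grad i k).sub (memLp_top_const _))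
    choose C hC using hbd
    have hC' : ∀ k, ∀ᵐ x ∂volume.restrict Ω, |G x i k - F i k| ≤ |C 0| + |C 1| := by
      intro k
      filter_upwards [hC k] with x hx
      refine hx.trans ?_
      fin_cases k
      · exact (le_abs_self _).trans (by simp)
      · exact (le_abs_self _).trans (by simp)
    exact exists_lipschitzWith_of_local (hWc i) (hW0 i) (by positivity) fun x hx =>
      eventually_abs_sub_le_of_weak_deriv_bound hΩ (hWc i) hC' (hweak i) hx
  refine ⟨W, hlip, hWcs, hW0, hWy, fun i k => ?_⟩
  obtain ⟨C, hC⟩ := hlip i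
  refine ae_eq_of_forall_setIntegral_mul_eq hΩ
    (hC.integrable_lineDeriv volume (hWcs i) _).restrict (hGi i k) fun φ hφ hc hs => ?_
  have h1 := hC.integral_mul_fderiv_eq volume hφ hc (EuclideanSpace.single k 1)
  have h2 := hweak i φ hφ hc hs k
  rw [setIntegral_eq_integral_of_forall_compl_eq_zero, h1] at h2
  · rw [← neg_inj, ← h2, setIntegral_eq_integral_of_forall_compl_eq_zero]
    intro x hx
    rw [image_eq_zero_of_notMem_tsupport fun h => hx (hs h), mul_zero]
  · intro x hx
    rw [hW0 i x hx, zero_mul]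

/-! ### Integral identities for the zero extension -/

namespace IsZeroExtension

variable {Ω : Set Plane} {F : Mat2} {y : Plane → Plane} {G : Plane → Mat2} {W : Fin 2 → Plane → ℝ}

theorem ae_lineDeriv_eq_zero (hW : IsZeroExtension Ω F y G W) (hΩ : IsOpen Ω) (i : Fin 2)
    (v : Plane) : ∀ᵐ x, x ∉ Ω → lineDeriv ℝ (W i) x v = 0 := by
  obtain ⟨C, hC⟩ := hW.lipschitz i
  exact hC.ae_lineDeriv_eq_zero volume hΩ.measurableSet.compl (hW.eq_zero i) v

theorem setIntegral_grad_sub (hW : IsZeroExtension Ω F y G W) (hΩ : IsOpen Ω) (i k : Fin 2) :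
    ∫ x in Ω, (G x i k - F i k) = 0 := by
  obtain ⟨C, hC⟩ := hW.lipschitz i
  rw [← hC.integral_lineDeriv_eq_zero volume (hW.hasCompactSupport i) (EuclideanSpace.single k 1),
    ← setIntegral_eq_integral_of_ae_compl_eq_zero (hW.ae_lineDeriv_eq_zero hΩ i _)]
  exact integral_congr_ae ((hW.ae_lineDeriv_eq i k).mono fun x hx => hx.symm)

/-- The determinant of a compactly supported gradient has integral zero. -/
theorem setIntegral_det_sub (hW : IsZeroExtension Ω F y G W) (hΩ : IsOpen Ω) :
    ∫ x in Ω, (G x - F).det = 0 := by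
  obtain ⟨C, hC⟩ := hW.lipschitz 0
  obtain ⟨D, hD⟩ := hW.lipschitz 1
  set e : Fin 2 → Plane := fun k => EuclideanSpace.single k 1
  have hint : ∀ k l, Integrable fun x => lineDeriv ℝ (W 0) x (e k) * lineDeriv ℝ (W 1) x (e l) :=
    fun k l => (hC.integrable_lineDeriv volume (hW.hasCompactSupport 0) _).mul_of_top_left
      (hD.memLp_lineDeriv _)
  have key := hC.integral_lineDeriv_mul_lineDeriv_comm volume hD (hW.hasCompactSupport 0)
    (hW.hasCompactSupport 1) (e 0) (e 1)
  rw [← sub_eq_zero, ← integral_sub (hint 0 1) (hint 1 0)] at key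
  rw [← key, ← setIntegral_eq_integral_of_ae_compl_eq_zero (s := Ω) (μ := volume)]
  · refine integral_congr_ae ?_
    filter_upwards [hW.ae_lineDeriv_eq 0 0, hW.ae_lineDeriv_eq 0 1, hW.ae_lineDeriv_eq 1 0,
      hW.ae_lineDeriv_eq 1 1] with x h00 h01 h10 h11
    simp only [e, h00, h01, h10, h11, Matrix.det_fin_two, Matrix.sub_apply]
  · filter_upwards [hW.ae_lineDeriv_eq_zero hΩ 0 (e 0), hW.ae_lineDeriv_eq_zero hΩ 0 (e 1)]
      with x h0 h1 hx
    rw [h0 hx, h1 hx, zero_mul, zero_mul, sub_zero]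

/-- On all test functions of the plane, not only on those supported in `Ω`, the function `y - F x`
has the weak gradient `G - F`. -/
theorem setIntegral_mul_fderiv (hW : IsZeroExtension Ω F y G W) (hΩ : IsOpen Ω) {φ : Plane → ℝ}
    (hφ : ContDiff ℝ ∞ φ) (hc : HasCompactSupport φ) (i k : Fin 2) :
    ∫ x in Ω, (y x i - (F *ᵥ x.ofLp) i) * fderiv ℝ φ x (EuclideanSpace.single k 1) =
      -∫ x in Ω, (G x i k - F i k) * φ x := by
  obtain ⟨C, hC⟩ := hW.lipschitz i
  have h := hC.integral_mul_fderiv_eq volume hφ hc (EuclideanSpace.single k 1)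
  have h1 : ∀ᵐ x, x ∉ Ω → lineDeriv ℝ (W i) x (EuclideanSpace.single k 1) * φ x = 0 := by
    filter_upwards [hW.ae_lineDeriv_eq_zero hΩ i (EuclideanSpace.single k 1)] with x h0 hx
    rw [h0 hx, zero_mul]
  rw [← setIntegral_eq_integral_of_ae_compl_eq_zero h1,
    ← setIntegral_eq_integral_of_forall_compl_eq_zero (s := Ω) (μ := volume)
      fun x hx => by rw [hW.eq_zero i x hx, zero_mul]] at h
  calc ∫ x in Ω, (y x i - (F *ᵥ x.ofLp) i) * fderiv ℝ φ x (EuclideanSpace.single k 1)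
      = ∫ x in Ω, W i x * fderiv ℝ φ x (EuclideanSpace.single k 1) :=
        integral_congr_ae ((hW.ae_eq i).mono fun x hx => by simp only [hx])
    _ = _ := h
    _ = -∫ x in Ω, (G x i k - F i k) * φ x :=
        congrArg Neg.neg
          (integral_congr_ae ((hW.ae_lineDeriv_eq i k).mono fun x hx => by simp only [hx]))

end IsZeroExtension

/-! ### Functions with a vanishing partial derivative -/

/-- A function on a bounded open set whose extension by zero has vanishing weak derivative in one
direction `e` vanishes: `t ↦ ∫ f ψ(· - t e)` is constant, and is zero for large `t`. -/
theorem ae_eq_zero_of_setIntegral_mul_fderiv_eq_zero {Ω : Set Plane} (hΩ : IsOpen Ω)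
    (hb : Bornology.IsBounded Ω) {f : Plane → ℝ} (hf : Integrable f (volume.restrict Ω))
    {e : Plane} (he : e ≠ 0)
    (h : ∀ φ : Plane → ℝ, ContDiff ℝ ∞ φ → HasCompactSupport φ →
      ∫ x in Ω, f x * fderiv ℝ φ x e = 0) :
    ∀ᵐ x ∂volume.restrict Ω, f x = 0 := by
  refine ae_eq_of_forall_setIntegral_mul_eq hΩ hf (integrable_zero _ _ _) fun ψ hψ hc hs => ?_
  simp only [zero_mul, integral_zero]
  set g : Plane → ℝ := fun z => ψ (-z) with hg
  have hgs : ContDiff ℝ ∞ g := hψ.comp contDiff_neg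
  have hgc : HasCompactSupport g := hc.comp_homeomorph (Homeomorph.neg Plane)
  set f₀ : Plane → ℝ := Ω.indicator f with hf₀
  have hf₀i : Integrable f₀ := (integrable_indicator_iff hΩ.measurableSet).2 hf
  set H : Plane → ℝ := fun p => ∫ z, f₀ z * g (p - z) with hH
  have hind : ∀ u : Plane → ℝ, ∫ z, f₀ z * u z = ∫ z in Ω, f z * u z := by
    intro u
    rw [← integral_indicator hΩ.measurableSet]
    congr 1 with z
    by_cases hz : z ∈ Ω <;> simp [hf₀, hz]
  have hconst : ∀ t : ℝ, H (t • e) = H ((0 : ℝ) • e) := by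
    refine fun t => is_const_of_deriv_eq_zero (f := fun t : ℝ => H (t • e)) ?_ ?_ t 0
    · intro t
      obtain ⟨T, hT, -⟩ := hasFDerivAt_integral_mul_comp_sub volume hf₀i.locallyIntegrable hgs hgc
        (t • e)
      exact (hT.comp_hasDerivAt t ((hasDerivAt_id t).smul_const e)).differentiableAt
    · intro t
      obtain ⟨T, hT, hTv⟩ := hasFDerivAt_integral_mul_comp_sub volume hf₀i.locallyIntegrable hgs hgc
        (t • e)
      have hd := (hT.comp_hasDerivAt t ((hasDerivAt_id t).smul_const e)).deriv
      refine hd.trans ?_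
      rw [one_smul, hTv, hind, ← neg_eq_zero, ← integral_neg,
        ← h (fun z => g (t • e - z)) (hgs.comp (contDiff_const.sub contDiff_id))
          (hgc.comp_const_sub _)]
      congr 1 with z
      rw [fderiv_comp_const_sub_apply hgs]
      ring
  -- the translates of the support of `ψ` leave the bounded set `Ω`
  obtain ⟨R, hR⟩ := hb.exists_norm_le
  obtain ⟨S, hS⟩ := hc.isCompact.isBounded.exists_norm_le
  set t : ℝ := (|R| + |S| + 1) / ‖e‖ with ht
  have hfar : H (t • e) = 0 := by
    rw [hH]
    simp only []
    rw [hind]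
    refine setIntegral_eq_zero_of_forall_eq_zero fun z hz => ?_
    have hz' : -(t • e - z) ∉ tsupport ψ := by
      intro hmem
      have h1 := hS _ hmem
      have h2 := hR _ hz
      have h3 : ‖t • e‖ = |R| + |S| + 1 := by
        rw [norm_smul, Real.norm_of_nonneg (by positivity), ht,
          div_mul_cancel₀ _ (norm_ne_zero_iff.2 he)]
      have h4 : ‖t • e‖ ≤ ‖z‖ + ‖-(t • e - z)‖ := by
        calc ‖t • e‖ = ‖z - -(t • e - z)‖ := by congr 1; abel
          _ ≤ _ := norm_sub_le _ _
      linarith [le_abs_self R, le_abs_self S]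
    rw [hg]
    simp only []
    rw [image_eq_zero_of_notMem_tsupport hz', mul_zero]
  have h0 := hconst t
  rw [hfar, hH] at h0
  simp only [zero_smul, zero_sub, hg, neg_neg] at h0
  rw [hind] at h0
  exact h0.symm

/-! ### Null Lagrangians -/

/-- The affine combinations of `1`, the matrix entries, and the determinant. -/
def nullLagrangian (c : ℝ) (b : Mat2) (d : ℝ) (A : Mat2) : ℝ :=
  c + (b 0 0 * A 0 0 + b 0 1 * A 0 1 + b 1 0 * A 1 0 + b 1 1 * A 1 1) + d * A.det

theorem continuous_nullLagrangian (c : ℝ) (b : Mat2) (d : ℝ) :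
    Continuous (nullLagrangian c b d) := by
  unfold nullLagrangian
  simp only [Matrix.det_fin_two]
  fun_prop

/-- The average of a null Lagrangian of `∇y` is determined by the affine boundary values. -/
theorem setIntegral_nullLagrangian {Ω : Set Plane} (hΩ : IsOpen Ω) (hb : Bornology.IsBounded Ω)
    {F : Mat2} {y : Plane → Plane} {G : Plane → Mat2} (hy : MemW1Infty Ω y G)
    (hF : HasAffineBoundaryValues Ω F y) (c : ℝ) (b : Mat2) (d : ℝ) :
    ∫ x in Ω, nullLagrangian c b d (G x) = volume.real Ω * nullLagrangian c b d F := by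
  obtain ⟨W, hW⟩ := exists_isZeroExtension hΩ hb hy hF
  have hm : ∀ i k, MemLp (fun x => G x i k - F i k) ∞ (volume.restrict Ω) := fun i k =>
    (hy.memLp_grad i k).sub (memLp_top_const _)
  have hi : ∀ i k, Integrable (fun x => G x i k - F i k) (volume.restrict Ω) := fun i k =>
    integrable_of_memLp_top hb (hm i k)
  have hdet : Integrable (fun x => (G x - F).det) (volume.restrict Ω) := by
    simp only [Matrix.det_fin_two, Matrix.sub_apply]
    exact ((hi 0 0).mul_of_top_left (hm 1 1)).sub ((hi 0 1).mul_of_top_left (hm 1 0))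
  have hone : Integrable (fun _ : Plane => nullLagrangian c b d F) (volume.restrict Ω) :=
    integrable_of_memLp_top hb (memLp_top_const _)
  have hexp : ∀ x, nullLagrangian c b d (G x) = nullLagrangian c b d F +
      ((b 0 0 + d * F 1 1) * (G x 0 0 - F 0 0) + ((b 0 1 - d * F 1 0) * (G x 0 1 - F 0 1) +
      ((b 1 0 - d * F 0 1) * (G x 1 0 - F 1 0) + ((b 1 1 + d * F 0 0) * (G x 1 1 - F 1 1) +
      d * (G x - F).det)))) := by
    intro x
    simp only [nullLagrangian, Matrix.det_fin_two, Matrix.sub_apply]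
    ring
  simp only [hexp]
  have j5 := hdet.const_mul d
  have j4 := ((hi 1 1).const_mul (b 1 1 + d * F 0 0)).fun_add j5
  have j3 := ((hi 1 0).const_mul (b 1 0 - d * F 0 1)).fun_add j4
  have j2 := ((hi 0 1).const_mul (b 0 1 - d * F 1 0)).fun_add j3
  have j1 := ((hi 0 0).const_mul (b 0 0 + d * F 1 1)).fun_add j2
  rw [integral_add hone j1, integral_add ((hi 0 0).const_mul _) j2,
    integral_add ((hi 0 1).const_mul _) j3, integral_add ((hi 1 0).const_mul _) j4,
    integral_add ((hi 1 1).const_mul _) j5]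
  simp only [integral_const_mul, hW.setIntegral_grad_sub hΩ, hW.setIntegral_det_sub hΩ,
    setIntegral_const, smul_eq_mul, mul_zero, add_zero]

/-! ### Geometry of the wells -/

theorem mul_wellOne_apply (δ : ℝ) (Q : Mat2) (i : Fin 2) :
    (Q * wellOne δ) i 0 = Q i 0 ∧ (Q * wellOne δ) i 1 = Q i 1 * (1 + δ) := by
  simp [wellOne, Matrix.mul_apply, Fin.sum_univ_two]

theorem mul_wellTwo_apply (δ : ℝ) (Q : Mat2) (i : Fin 2) :
    (Q * wellTwo δ) i 0 = Q i 0 ∧ (Q * wellTwo δ) i 1 = Q i 1 * (1 - δ) := by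
  simp [wellTwo, Matrix.mul_apply, Fin.sum_univ_two]

/-- The first column of a matrix in the wells is a unit vector, and the second column is its rotation
by a right angle, stretched by `1 ± δ`. -/
theorem exists_stretch_of_mem_twoWell {δ : ℝ} {A : Mat2} (hA : A ∈ twoWell δ) :
    A 0 0 ^ 2 + A 1 0 ^ 2 = 1 ∧
      ∃ σ : ℝ, (σ = 1 + δ ∨ σ = 1 - δ) ∧ A 0 1 = -A 1 0 * σ ∧ A 1 1 = A 0 0 * σ := by
  rcases hA with ⟨Q, hQ, rfl⟩ | ⟨Q, hQ, rfl⟩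
  · obtain ⟨h1, h2, h3⟩ := Matrix.mem_specialOrthogonalGroup_fin_two_iff.1 hQ
    simp only [mul_wellOne_apply]
    exact ⟨by rw [← h3, h2]; ring, 1 + δ, Or.inl rfl, by rw [h2], by rw [h1]⟩
  · obtain ⟨h1, h2, h3⟩ := Matrix.mem_specialOrthogonalGroup_fin_two_iff.1 hQ
    simp only [mul_wellTwo_apply]
    exact ⟨by rw [← h3, h2]; ring, 1 - δ, Or.inr rfl, by rw [h2], by rw [h1]⟩

theorem det_eq_of_stretch {A : Mat2} {σ : ℝ} (h : A 0 0 ^ 2 + A 1 0 ^ 2 = 1)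
    (h0 : A 0 1 = -A 1 0 * σ) (h1 : A 1 1 = A 0 0 * σ) : A.det = σ := by
  rw [Matrix.det_fin_two, h0, h1]
  linear_combination σ * h

/-- A matrix in the wells is determined, up to the choice of the well, by its first column. -/
theorem eq_or_eq_of_mem_twoWell {δ : ℝ} {A Q : Mat2} (hA : A ∈ twoWell δ) (hQ : Q ∈ SO2)
    (h0 : A 0 0 = Q 0 0) (h1 : A 1 0 = Q 1 0) : A = Q * wellOne δ ∨ A = Q * wellTwo δ := by
  obtain ⟨q1, q2, q3⟩ := Matrix.mem_specialOrthogonalGroup_fin_two_iff.1 hQ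
  obtain ⟨-, σ, hσ, hA0, hA1⟩ := exists_stretch_of_mem_twoWell hA
  rcases hσ with rfl | rfl
  · left
    ext i k
    fin_cases i <;> fin_cases k <;> simp [mul_wellOne_apply, h0, h1, hA0, hA1, q1, q2]
  · right
    ext i k
    fin_cases i <;> fin_cases k <;> simp [mul_wellTwo_apply, h0, h1, hA0, hA1, q1, q2]

theorem abs_apply_le_of_mem_twoWell {δ : ℝ} (hδ : δ ∈ Ioo (-1 : ℝ) 1) {A : Mat2}
    (hA : A ∈ twoWell δ) (i k : Fin 2) : |A i k| ≤ 2 := by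
  obtain ⟨hδ1, hδ2⟩ := hδ
  obtain ⟨h, σ, hσ, h0, h1⟩ := exists_stretch_of_mem_twoWell hA
  have hσ2 : |σ| ≤ 2 := by rcases hσ with rfl | rfl <;> rw [abs_le] <;> constructor <;> linarith
  have a0 : |A 0 0| ≤ 1 := abs_le_one_iff_mul_self_le_one.2 (by nlinarith [sq_nonneg (A 1 0)])
  have a1 : |A 1 0| ≤ 1 := abs_le_one_iff_mul_self_le_one.2 (by nlinarith [sq_nonneg (A 0 0)])
  have hmul : ∀ a : ℝ, |a| ≤ 1 → |a * σ| ≤ 2 := fun a ha => by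
    rw [abs_mul]
    calc |a| * |σ| ≤ 1 * 2 := mul_le_mul ha hσ2 (abs_nonneg _) zero_le_one
      _ = 2 := one_mul 2
  fin_cases i <;> fin_cases k <;> simp only [Fin.zero_eta, Fin.mk_one, Fin.isValue]
  · linarith
  · rw [h0]; exact hmul _ (by rwa [abs_neg])
  · linarith
  · rw [h1]; exact hmul _ a0

theorem SO2_eq_of_col_eq {Q Q' : Mat2} (hQ : Q ∈ SO2) (hQ' : Q' ∈ SO2)
    (h0 : Q 0 0 = Q' 0 0) (h1 : Q 1 0 = Q' 1 0) : Q = Q' := by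
  obtain ⟨q1, q2, -⟩ := Matrix.mem_specialOrthogonalGroup_fin_two_iff.1 hQ
  obtain ⟨r1, r2, -⟩ := Matrix.mem_specialOrthogonalGroup_fin_two_iff.1 hQ'
  ext i k
  fin_cases i <;> fin_cases k <;> simp only [Fin.zero_eta, Fin.mk_one, Fin.isValue]
  · exact h0
  · rw [q2, r2, h1]
  · exact h1
  · rw [← q1, ← r1, h0]

/-! ### Rank-one connections -/

theorem Matrix.det_eq_zero_of_rank_eq_one {A : Mat2} (h : A.rank = 1) : A.det = 0 := by
  by_contra hd
  have := Matrix.rank_of_isUnit A ((Matrix.isUnit_iff_isUnit_det A).2 (isUnit_iff_ne_zero.2 hd))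
  simp [h] at this

theorem SO2_eq_one_of_apply_zero_zero {Q : Mat2} (hQ : Q ∈ SO2) (h : Q 0 0 = 1) : Q = 1 := by
  obtain ⟨-, q2, q3⟩ := Matrix.mem_specialOrthogonalGroup_fin_two_iff.1 hQ
  refine SO2_eq_of_col_eq hQ (one_mem _) (by simpa using h) ?_
  have : Q 1 0 ^ 2 = 0 := by rw [h, q2] at q3; linarith
  simpa using this

theorem rank_mul_wellOne_sub_wellTwo_eq_one_iff {δ : ℝ} (hδ : δ ≠ 0) {Q : Mat2} (hQ : Q ∈ SO2) :
    (Q * wellOne δ - wellTwo δ).rank = 1 ↔ Q = 1 := by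
  constructor
  · intro h
    obtain ⟨q1, q2, q3⟩ := Matrix.mem_specialOrthogonalGroup_fin_two_iff.1 hQ
    have hd := Matrix.det_eq_zero_of_rank_eq_one h
    refine SO2_eq_one_of_apply_zero_zero hQ ?_
    simp only [Matrix.det_fin_two, Matrix.sub_apply, mul_wellOne_apply, wellTwo, Matrix.of_apply,
      Matrix.cons_val', Matrix.cons_val_zero, Matrix.cons_val_one, Matrix.cons_val_fin_one] at hd
    rw [← q1] at hd
    rw [q2] at hd q3
    linear_combination (-1 / 2) * hd + (1 + δ) / 2 * q3
  · rintro rfl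
    have : (1 : Mat2) * wellOne δ - wellTwo δ = Matrix.diagonal ![0, 2 * δ] := by
      ext i k
      fin_cases i <;> fin_cases k <;> simp [wellOne, wellTwo]
      ring
    rw [this, Matrix.rank_diagonal]
    have hset : {i : Fin 2 // (![0, 2 * δ] : Fin 2 → ℝ) i ≠ 0} ≃ Unit :=
      { toFun := fun _ => ()
        invFun := fun _ => ⟨1, by simpa using hδ⟩
        left_inv := by
          rintro ⟨i, hi⟩
          fin_cases i
          · simp at hi
          · rfl
        right_inv := fun _ => rfl }
    rw [Fintype.card_congr hset, Fintype.card_unit]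

theorem rank_mul_sub_self_ne_one {Q B : Mat2} (hQ : Q ∈ SO2) (hB : B.det ≠ 0) :
    (Q * B - B).rank ≠ 1 := by
  intro h
  obtain ⟨q1, q2, q3⟩ := Matrix.mem_specialOrthogonalGroup_fin_two_iff.1 hQ
  have hd := Matrix.det_eq_zero_of_rank_eq_one h
  have hfac : Q * B - B = (Q - 1) * B := by rw [sub_mul, one_mul]
  rw [hfac, Matrix.det_mul, mul_eq_zero, or_iff_left hB] at hd
  have h1 : Q = 1 := by
    refine SO2_eq_one_of_apply_zero_zero hQ ?_
    simp only [Matrix.det_fin_two, Matrix.sub_apply, Matrix.one_fin_two,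
      Matrix.of_apply, Matrix.cons_val', Matrix.cons_val_zero, Matrix.cons_val_one,
      Matrix.cons_val_fin_one] at hd
    rw [← q1] at hd
    rw [q2] at hd q3
    linear_combination (-1 / 2) * hd + (1 / 2) * q3
  simp [h1] at h

theorem det_wellOne_ne_zero {δ : ℝ} (hδ : δ ∈ Ioo (-1 : ℝ) 1) : (wellOne δ).det ≠ 0 := by
  have := hδ.1
  simp only [wellOne, Matrix.det_fin_two_of]
  intro h
  linarith

theorem det_wellTwo_ne_zero {δ : ℝ} (hδ : δ ∈ Ioo (-1 : ℝ) 1) : (wellTwo δ).det ≠ 0 := by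
  have := hδ.2
  simp only [wellTwo, Matrix.det_fin_two_of]
  intro h
  linarith

/-! ### Young measures supported in the wells -/

instance : SecondCountableTopology Mat2 :=
  inferInstanceAs (SecondCountableTopology (Fin 2 → Fin 2 → ℝ))

instance : LocallyCompactSpace Mat2 := inferInstanceAs (LocallyCompactSpace (Fin 2 → Fin 2 → ℝ))

theorem isCompact_setOf_abs_apply_le (R : ℝ) : IsCompact {A : Mat2 | ∀ i k, |A i k| ≤ R} := by
  have h : IsCompact (univ.pi fun _ : Fin 2 => univ.pi fun _ : Fin 2 => Icc (-R) R) :=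
    isCompact_univ_pi fun _ => isCompact_univ_pi fun _ => isCompact_Icc
  have heq : {A : Mat2 | ∀ i k, |A i k| ≤ R} =
      univ.pi fun _ : Fin 2 => univ.pi fun _ : Fin 2 => Icc (-R) R := by
    ext A
    exact ⟨fun hA i _ k _ => abs_le.1 (hA i k), fun hA i k => abs_le.2 (hA i trivial k trivial)⟩
  rw [heq]
  exact h

theorem exists_zeroAtInfty_eq_of_abs_apply_le {f : Mat2 → ℝ} (hf : Continuous f) (R : ℝ) :
    ∃ g : C₀(Mat2, ℝ), ∀ A, (∀ i k, |A i k| ≤ R) → g A = f A := by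
  obtain ⟨χ, hχ1, -, hχc, -⟩ := exists_continuous_one_zero_of_isCompact
    (isCompact_setOf_abs_apply_le R) isClosed_empty (disjoint_empty _)
  refine ⟨⟨⟨fun A => χ A * f A, χ.continuous.mul hf⟩, ?_⟩, fun A hA => ?_⟩
  · exact HasCompactSupport.is_zero_at_infty (f := fun A => χ A * f A) hχc.mul_right
  · change χ A * f A = f A
    rw [hχ1 hA, Pi.one_apply, one_mul]

theorem exists_abs_le_of_mem_twoWell {δ : ℝ} (hδ : δ ∈ Ioo (-1 : ℝ) 1) {f : Mat2 → ℝ}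
    (hf : Continuous f) : ∃ M, ∀ A ∈ twoWell δ, |f A| ≤ M := by
  obtain ⟨M, hM⟩ := ((isCompact_setOf_abs_apply_le 2).image hf).isBounded.exists_norm_le
  exact ⟨M, fun A hA => hM _ ⟨A, fun i k => abs_apply_le_of_mem_twoWell hδ hA i k, rfl⟩⟩

theorem integrable_of_ae_mem_twoWell {δ : ℝ} (hδ : δ ∈ Ioo (-1 : ℝ) 1) {ν : Measure Mat2}
    [IsFiniteMeasure ν] (hν : ∀ᵐ A ∂ν, A ∈ twoWell δ) {f : Mat2 → ℝ} (hf : Continuous f) :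
    Integrable f ν := by
  obtain ⟨M, hM⟩ := exists_abs_le_of_mem_twoWell hδ hf
  exact Integrable.of_bound hf.aestronglyMeasurable M (hν.mono hM)

/-- For bounded gradients and a Young measure living on the compact set `K`, the convergence
`f(∇yʲ) ⇀ ⟨ν_x, f⟩` extends from `C₀` to all continuous functions `f`. -/
theorem GeneratesYoungMeasure.weakStarTendsto_of_continuous {δ : ℝ} (hδ : δ ∈ Ioo (-1 : ℝ) 1)
    {Ω : Set Plane} {Gj : ℕ → Plane → Mat2} {ν : Plane → Measure Mat2}
    (hY : GeneratesYoungMeasure Ω Gj ν)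
    (hK : ∀ᵐ x ∂volume.restrict Ω, ∀ᵐ A ∂ν x, A ∈ twoWell δ)
    (hG : ∃ C : ℝ, ∀ j, ∀ᵐ x ∂volume.restrict Ω, ∀ i k, |Gj j x i k| ≤ C)
    {f : Mat2 → ℝ} (hf : Continuous f) :
    WeakStarTendsto Ω (fun j x => f (Gj j x)) (fun x => ∫ A, f A ∂ν x) ∧
      MemLp (fun x => ∫ A, f A ∂ν x) ∞ (volume.restrict Ω) := by
  obtain ⟨C, hC⟩ := hG
  obtain ⟨g, hg⟩ := exists_zeroAtInfty_eq_of_abs_apply_le hf (max C 2)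
  have hν : ∀ᵐ x ∂volume.restrict Ω, ∫ A, g A ∂ν x = ∫ A, f A ∂ν x := by
    filter_upwards [hK] with x hx
    refine integral_congr_ae ?_
    filter_upwards [hx] with A hA
    exact hg A fun i k => (abs_apply_le_of_mem_twoWell hδ hA i k).trans (le_max_right _ _)
  have hj : ∀ j, ∀ᵐ x ∂volume.restrict Ω, g (Gj j x) = f (Gj j x) := fun j =>
    (hC j).mono fun x hx => hg _ fun i k => (hx i k).trans (le_max_left _ _)
  constructor
  · intro φ hφ
    have h := hY.tendsto g φ hφ
    have hlim : ∫ x in Ω, φ x * ∫ A, g A ∂ν x = ∫ x in Ω, φ x * ∫ A, f A ∂ν x :=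
      integral_congr_ae (hν.mono fun x hx => by simp only [hx])
    simp only [hlim] at h
    refine h.congr fun j => ?_
    exact integral_congr_ae ((hj j).mono fun x hx => by simp only [hx])
  · obtain ⟨M, hM⟩ := exists_abs_le_of_mem_twoWell hδ hf
    refine memLp_top_of_bound ((hY.aemeasurable g).congr hν).aestronglyMeasurable M ?_
    filter_upwards [hK, hY.isProbabilityMeasure] with x hx hp
    simpa using norm_integral_le_of_norm_le_const (f := f) (hx.mono hM)

/-- Jensen's equality for null Lagrangians: if `f` is nonnegative on the wells then `f F ≥ 0`, and
in the case of equality `f` vanishes almost everywhere with respect to the Young measure. -/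
theorem nullLagrangian_nonneg_and_ae_eq_zero {δ : ℝ} (hδ : δ ∈ Ioo (-1 : ℝ) 1) {Ω : Set Plane}
    (hΩ : IsOpen Ω) (hb : Bornology.IsBounded Ω) (hne : Ω.Nonempty) {F : Mat2}
    {yj : ℕ → Plane → Plane} {Gj : ℕ → Plane → Mat2} {ν : Plane → Measure Mat2}
    (hy : ∀ j, MemW1Infty Ω (yj j) (Gj j)) (hF : ∀ j, HasAffineBoundaryValues Ω F (yj j))
    (hY : GeneratesYoungMeasure Ω Gj ν)
    (hK : ∀ᵐ x ∂volume.restrict Ω, ∀ᵐ A ∂ν x, A ∈ twoWell δ)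
    (hG : ∃ C : ℝ, ∀ j, ∀ᵐ x ∂volume.restrict Ω, ∀ i k, |Gj j x i k| ≤ C)
    (c : ℝ) (b : Mat2) (d : ℝ) (hpos : ∀ A ∈ twoWell δ, 0 ≤ nullLagrangian c b d A) :
    0 ≤ nullLagrangian c b d F ∧ (nullLagrangian c b d F = 0 →
      ∀ᵐ x ∂volume.restrict Ω, ∀ᵐ A ∂ν x, nullLagrangian c b d A = 0) := by
  have hc := continuous_nullLagrangian c b d
  obtain ⟨htend, hmem⟩ := hY.weakStarTendsto_of_continuous hδ hK hG hc
  have hvol : 0 < volume.real Ω :=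
    ENNReal.toReal_pos (hΩ.measure_pos volume hne).ne' hb.measure_lt_top.ne
  have hint : ∫ x in Ω, ∫ A, nullLagrangian c b d A ∂ν x =
      volume.real Ω * nullLagrangian c b d F := by
    have h := htend (fun _ => 1) (integrable_of_memLp_top hb (memLp_top_const 1))
    simp only [one_mul, setIntegral_nullLagrangian hΩ hb (hy _) (hF _)] at h
    exact tendsto_nhds_unique h tendsto_const_nhds
  have h0 : ∀ᵐ x ∂volume.restrict Ω, 0 ≤ ∫ A, nullLagrangian c b d A ∂ν x := by
    filter_upwards [hK] with x hx
    exact integral_nonneg_of_ae (hx.mono hpos)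
  refine ⟨?_, fun hzero => ?_⟩
  · have := integral_nonneg_of_ae h0
    rw [hint] at this
    exact nonneg_of_mul_nonneg_right this hvol
  · rw [hzero, mul_zero, integral_eq_zero_iff_of_nonneg_ae h0 (integrable_of_memLp_top hb hmem)]
      at hint
    filter_upwards [hint, hK, hY.isProbabilityMeasure] with x hx hxK hp
    exact (integral_eq_zero_iff_of_nonneg_ae (hxK.mono hpos)
      (integrable_of_ae_mem_twoWell hδ hxK hc)).1 hx

/-- The determinant constraint forces the first column of `F` to be a unit vector, and the
first column of the Young measure to be deterministic. -/
theorem first_column_rigidity {δ : ℝ} (hδ : δ ∈ Ioo (-1 : ℝ) 1) {Ω : Set Plane}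
    (hΩ : IsOpen Ω) (hb : Bornology.IsBounded Ω) (hne : Ω.Nonempty) {F : Mat2}
    {yj : ℕ → Plane → Plane} {Gj : ℕ → Plane → Mat2} {ν : Plane → Measure Mat2}
    (hy : ∀ j, MemW1Infty Ω (yj j) (Gj j)) (hF : ∀ j, HasAffineBoundaryValues Ω F (yj j))
    (hY : GeneratesYoungMeasure Ω Gj ν)
    (hK : ∀ᵐ x ∂volume.restrict Ω, ∀ᵐ A ∂ν x, A ∈ twoWell δ)
    (hG : ∃ C : ℝ, ∀ j, ∀ᵐ x ∂volume.restrict Ω, ∀ i k, |Gj j x i k| ≤ C) :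
    F 0 0 ^ 2 + F 1 0 ^ 2 = 1 ∧
      ∀ᵐ x ∂volume.restrict Ω, ∀ᵐ A ∂ν x, A 0 0 = F 0 0 ∧ A 1 0 = F 1 0 := by
  have J := nullLagrangian_nonneg_and_ae_eq_zero hδ hΩ hb hne hy hF hY hK hG
  have hσpos : ∀ σ : ℝ, σ = 1 + δ ∨ σ = 1 - δ → 1 - |δ| ≤ σ := by
    rintro σ (rfl | rfl)
    · linarith [neg_abs_le δ]
    · linarith [le_abs_self δ]
  have hδ1 : 0 < 1 - |δ| := by
    have := abs_lt.2 ⟨hδ.1, hδ.2⟩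
    linarith
  have hdet : 0 < F.det := by
    have h := (J (-(1 - |δ|)) 0 1 fun A hA => by
      obtain ⟨h, σ, hσ, h0, h1⟩ := exists_stretch_of_mem_twoWell hA
      have := hσpos σ hσ
      simp only [nullLagrangian, Matrix.zero_apply, det_eq_of_stretch h h0 h1]
      linarith).1
    simp only [nullLagrangian, Matrix.zero_apply] at h
    linarith
  -- on the wells, this null Lagrangian is `det A * |A e₁ - F e₁|²`
  have hge : 0 ≤ (F 0 0 ^ 2 + F 1 0 ^ 2 - 1) * F.det := by
    have h := (J 0 !![0, 2 * F 1 0; 0, -2 * F 0 0] (1 + (F 0 0 ^ 2 + F 1 0 ^ 2)) fun A hA => by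
      obtain ⟨h, σ, hσ, h0, h1⟩ := exists_stretch_of_mem_twoWell hA
      have hσ' : 0 ≤ σ := hδ1.le.trans (hσpos σ hσ)
      have : nullLagrangian 0 !![0, 2 * F 1 0; 0, -2 * F 0 0] (1 + (F 0 0 ^ 2 + F 1 0 ^ 2)) A =
          σ * ((A 0 0 - F 0 0) ^ 2 + (A 1 0 - F 1 0) ^ 2) := by
        simp only [nullLagrangian, det_eq_of_stretch h h0 h1, h0, h1, Matrix.of_apply,
          Matrix.cons_val', Matrix.cons_val_zero, Matrix.cons_val_one, Matrix.cons_val_fin_one]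
        linear_combination (-σ) * h
      rw [this]
      positivity).1
    simp only [nullLagrangian, Matrix.det_fin_two, Matrix.of_apply, Matrix.cons_val',
      Matrix.cons_val_zero, Matrix.cons_val_one, Matrix.cons_val_fin_one] at h ⊢
    linarith
  have hge' : 1 ≤ F 0 0 ^ 2 + F 1 0 ^ 2 := by
    have := nonneg_of_mul_nonneg_left hge hdet
    linarith
  -- on the wells, this null Lagrangian is `|A e₁ - F e₁|²`
  have hL : ∀ A ∈ twoWell δ, nullLagrangian (1 + (F 0 0 ^ 2 + F 1 0 ^ 2))
      !![-2 * F 0 0, 0; -2 * F 1 0, 0] 0 A = (A 0 0 - F 0 0) ^ 2 + (A 1 0 - F 1 0) ^ 2 := by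
    intro A hA
    obtain ⟨h, -⟩ := exists_stretch_of_mem_twoWell hA
    simp only [nullLagrangian, Matrix.of_apply, Matrix.cons_val', Matrix.cons_val_zero,
      Matrix.cons_val_one, Matrix.cons_val_fin_one]
    linear_combination -h
  obtain ⟨hle, hzero⟩ := J (1 + (F 0 0 ^ 2 + F 1 0 ^ 2)) !![-2 * F 0 0, 0; -2 * F 1 0, 0] 0
    fun A hA => by rw [hL A hA]; positivity
  have hval : nullLagrangian (1 + (F 0 0 ^ 2 + F 1 0 ^ 2)) !![-2 * F 0 0, 0; -2 * F 1 0, 0] 0 F =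
      1 - (F 0 0 ^ 2 + F 1 0 ^ 2) := by
    simp only [nullLagrangian, Matrix.of_apply, Matrix.cons_val', Matrix.cons_val_zero,
      Matrix.cons_val_one, Matrix.cons_val_fin_one]
    ring
  rw [hval] at hle hzero
  have hone : F 0 0 ^ 2 + F 1 0 ^ 2 = 1 := by linarith
  refine ⟨hone, ?_⟩
  filter_upwards [hzero (by linarith), hK] with x hx hxK
  filter_upwards [hx, hxK] with A hA hAK
  rw [hL A hAK] at hA
  constructor <;> nlinarith [sq_nonneg (A 0 0 - F 0 0), sq_nonneg (A 1 0 - F 1 0)]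

/-! ### Simple laminates -/

theorem exists_eq_two_diracs {ν : Measure Mat2} [IsProbabilityMeasure ν] {a b : Mat2}
    (h : ∀ᵐ A ∂ν, A = a ∨ A = b) :
    ∃ t ∈ Icc (0 : ℝ) 1,
      ν = ENNReal.ofReal t • Measure.dirac a + ENNReal.ofReal (1 - t) • Measure.dirac b := by
  by_cases hab : a = b
  · subst hab
    refine ⟨1, by simp, ?_⟩
    have h1 : ν.restrict {a} = ν := by
      rw [Measure.restrict_eq_self_of_ae_mem]
      filter_upwards [h] with A hA
      simpa using hA
    have h2 : ν {a} = 1 := by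
      rw [← Measure.restrict_apply_univ, h1, measure_univ]
    rw [Measure.restrict_singleton, h2, one_smul] at h1
    simp [h1]
  · refine ⟨ν.real {a}, ⟨measureReal_nonneg, measureReal_le_one⟩, ?_⟩
    have hd : Disjoint ({a} : Set Mat2) {b} := by simpa using hab
    have h1 : ν.restrict ({a} ∪ {b}) = ν := by
      rw [Measure.restrict_eq_self_of_ae_mem]
      exact h
    rw [Measure.restrict_union hd (measurableSet_singleton b), Measure.restrict_singleton,
      Measure.restrict_singleton] at h1
    have h2 : ν {a} + ν {b} = 1 := by
      have := congrArg (fun m : Measure Mat2 => m univ) h1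
      simpa using this
    have h3 : 1 - ν.real {a} = ν.real {b} := by
      have := congrArg ENNReal.toReal h2
      rw [ENNReal.toReal_add (measure_ne_top _ _) (measure_ne_top _ _)] at this
      simp only [ENNReal.toReal_one] at this
      simp only [Measure.real]
      linarith
    rw [h3, ofReal_measureReal, ofReal_measureReal, h1]

theorem integral_simpleLaminate {δ : ℝ} {Q : Mat2} {t : ℝ} (ht : t ∈ Icc (0 : ℝ) 1)
    (f : Mat2 → ℝ) : ∫ A, f A ∂simpleLaminate δ Q t =
      t * f (Q * wellOne δ) + (1 - t) * f (Q * wellTwo δ) := by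
  have h : ∀ a : Mat2, Integrable f (Measure.dirac a) := fun a => integrable_dirac (by simp)
  have h1 : 0 ≤ 1 - t := sub_nonneg.2 ht.2
  rw [simpleLaminate, integral_add_measure ((h _).smul_measure ENNReal.ofReal_ne_top)
    ((h _).smul_measure ENNReal.ofReal_ne_top), integral_smul_measure, integral_smul_measure,
    integral_dirac, integral_dirac, ENNReal.toReal_ofReal ht.1, ENNReal.toReal_ofReal h1,
    smul_eq_mul, smul_eq_mul]

theorem simpleLaminate_zero_congr {Q : Mat2} {t s : ℝ} (ht : t ∈ Icc (0 : ℝ) 1)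
    (hs : s ∈ Icc (0 : ℝ) 1) : simpleLaminate 0 Q t = simpleLaminate 0 Q s := by
  have key : ∀ r ∈ Icc (0 : ℝ) 1, simpleLaminate 0 Q r = Measure.dirac (Q * wellOne 0) := by
    intro r hr
    have h : wellTwo 0 = wellOne 0 := by simp [wellOne, wellTwo]
    rw [simpleLaminate, h, ← add_smul, ← ENNReal.ofReal_add hr.1 (sub_nonneg.2 hr.2)]
    simp
  rw [key t ht, key s hs]

theorem integral_apply_zero_simpleLaminate {δ : ℝ} {Q : Mat2} {t : ℝ} (ht : t ∈ Icc (0 : ℝ) 1)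
    (i : Fin 2) : ∫ A, A i 0 ∂simpleLaminate δ Q t = Q i 0 := by
  rw [integral_simpleLaminate ht, (mul_wellOne_apply δ Q i).1, (mul_wellTwo_apply δ Q i).1]
  ring

theorem integral_apply_one_simpleLaminate {δ : ℝ} {Q : Mat2} {t : ℝ} (ht : t ∈ Icc (0 : ℝ) 1)
    (i : Fin 2) : ∫ A, A i 1 ∂simpleLaminate δ Q t = Q i 1 * (1 + (2 * t - 1) * δ) := by
  rw [integral_simpleLaminate ht, (mul_wellOne_apply δ Q i).2, (mul_wellTwo_apply δ Q i).2]
  ring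

/-- For fixed `Q ∈ SO(2)` and `δ ≠ 0`, the volume fraction of a simple laminate is determined by its
barycenter. -/
theorem eq_of_integral_simpleLaminate_eq {δ : ℝ} (hδ : δ ≠ 0) {Q : Mat2} (hQ : Q ∈ SO2) {t s : ℝ}
    (ht : t ∈ Icc (0 : ℝ) 1) (hs : s ∈ Icc (0 : ℝ) 1)
    (h : ∀ i, ∫ A, A i 1 ∂simpleLaminate δ Q t = ∫ A, A i 1 ∂simpleLaminate δ Q s) : t = s := by
  simp only [integral_apply_one_simpleLaminate ht, integral_apply_one_simpleLaminate hs] at h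
  obtain ⟨q1, q2, q3⟩ := Matrix.mem_specialOrthogonalGroup_fin_two_iff.1 hQ
  have h0 := h 0
  have h1 := h 1
  rw [← q1] at h1
  have : δ * (t - s) = 0 := by
    linear_combination (-(δ * (t - s))) * q3 + (1 / 2) * Q 0 1 * h0 + (1 / 2) * Q 0 0 * h1
  have := (mul_eq_zero.1 this).resolve_left hδ
  linarith

theorem simpleLaminate_injective {δ : ℝ} {Q Q' : Mat2} (hQ : Q ∈ SO2) (hQ' : Q' ∈ SO2) {t s : ℝ}
    (ht : t ∈ Icc (0 : ℝ) 1) (hs : s ∈ Icc (0 : ℝ) 1)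
    (h : simpleLaminate δ Q t = simpleLaminate δ Q' s) : Q = Q' ∧ (δ ≠ 0 → t = s) := by
  have hcol : ∀ i, Q i 0 = Q' i 0 := fun i => by
    rw [← integral_apply_zero_simpleLaminate (δ := δ) (Q := Q) ht, h,
      integral_apply_zero_simpleLaminate hs]
  have hQQ : Q = Q' := SO2_eq_of_col_eq hQ hQ' (hcol 0) (hcol 1)
  subst hQQ
  exact ⟨rfl, fun hδ => eq_of_integral_simpleLaminate_eq hδ hQ ht hs fun i => by rw [h]⟩

/-! ### Rigidity -/

theorem WeakStarTendsto.setIntegral_mul {Ω : Set Plane} {g : ℕ → Plane → ℝ} {h : Plane → ℝ}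
    (hg : WeakStarTendsto Ω g h) {φ : Plane → ℝ} (hφ : Continuous φ) (hc : HasCompactSupport φ) :
    Tendsto (fun j => ∫ x in Ω, g j x * φ x) atTop (𝓝 (∫ x in Ω, h x * φ x)) := by
  simpa only [mul_comm] using hg φ (hφ.integrable_of_hasCompactSupport hc).restrict

/-- The identity expressing that `G - F` is the weak gradient of the zero extension of `y - F x`
passes to weak-* limits. -/
theorem setIntegral_mul_fderiv_of_weakStarTendsto {Ω : Set Plane} (hΩ : IsOpen Ω)
    (hb : Bornology.IsBounded Ω) {F : Mat2} {yj : ℕ → Plane → Plane} {Gj : ℕ → Plane → Mat2}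
    (hy : ∀ j, MemW1Infty Ω (yj j) (Gj j)) (hF : ∀ j, HasAffineBoundaryValues Ω F (yj j))
    {u h : Plane → ℝ} (hu : Integrable u (volume.restrict Ω))
    (hh : Integrable h (volume.restrict Ω)) {i k : Fin 2}
    (hyu : WeakStarTendsto Ω (fun j x => yj j x i) u)
    (hGh : WeakStarTendsto Ω (fun j x => Gj j x i k) h)
    {φ : Plane → ℝ} (hφ : ContDiff ℝ ∞ φ) (hc : HasCompactSupport φ) :
    ∫ x in Ω, (u x - (F *ᵥ x.ofLp) i) * fderiv ℝ φ x (EuclideanSpace.single k 1) =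
      -∫ x in Ω, (h x - F i k) * φ x := by
  have hd : Continuous fun x => fderiv ℝ φ x (EuclideanSpace.single k 1) :=
    (hφ.continuous_fderiv (by simp)).clm_apply continuous_const
  have hdc : HasCompactSupport fun x => fderiv ℝ φ x (EuclideanSpace.single k 1) :=
    hc.fderiv_apply ℝ _
  -- subtracting a fixed integrable function inside the pairing with a continuous test function
  have hsub : ∀ {p q ψ : Plane → ℝ}, Integrable p (volume.restrict Ω) →
      Integrable q (volume.restrict Ω) → Continuous ψ → HasCompactSupport ψ →
      ∫ x in Ω, (p x - q x) * ψ x = (∫ x in Ω, p x * ψ x) - ∫ x in Ω, q x * ψ x := by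
    intro p q ψ hp hq hψ hψc
    obtain ⟨C, hC⟩ := hψ.bounded_above_of_compact_support hψc
    rw [← integral_sub (hp.mul_bdd hψ.aestronglyMeasurable (.of_forall hC))
      (hq.mul_bdd hψ.aestronglyMeasurable (.of_forall hC))]
    simp only [sub_mul]
  have hℓ := integrable_of_memLp_top hb (Plane.memLp_mulVec hΩ hb F i)
  have hconst : Integrable (fun _ => F i k) (volume.restrict Ω) :=
    integrable_of_memLp_top hb (memLp_top_const _)
  have hj : ∀ j, (∫ x in Ω, yj j x i * fderiv ℝ φ x (EuclideanSpace.single k 1)) -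
      ∫ x in Ω, (F *ᵥ x.ofLp) i * fderiv ℝ φ x (EuclideanSpace.single k 1) =
      -((∫ x in Ω, Gj j x i k * φ x) - ∫ x in Ω, F i k * φ x) := by
    intro j
    obtain ⟨W, hW⟩ := exists_isZeroExtension hΩ hb (hy j) (hF j)
    rw [← hsub (integrable_of_memLp_top hb ((hy j).memLp i)) hℓ hd hdc,
      ← hsub (integrable_of_memLp_top hb ((hy j).memLp_grad i k)) hconst hφ.continuous hc]
    exact hW.setIntegral_mul_fderiv hΩ hφ hc i k
  rw [hsub hu hℓ hd hdc, hsub hh hconst hφ.continuous hc]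
  have l1 := (hyu.setIntegral_mul hd hdc).sub_const
    (∫ x in Ω, (F *ᵥ x.ofLp) i * fderiv ℝ φ x (EuclideanSpace.single k 1))
  have l2 := ((hGh.setIntegral_mul hφ.continuous hc).sub_const (∫ x in Ω, F i k * φ x)).neg
  simp only [hj] at l1
  exact tendsto_nhds_unique l1 l2

/-- Rigidity: if the Young measure is supported in the wells and the boundary values are
affine, then the Young measure is one fixed simple laminate, and the weak limit is affine. -/
theorem twoWell_rigidity {δ : ℝ} (hδ : δ ∈ Ioo (-1 : ℝ) 1) {Ω : Set Plane}
    (hΩ : IsOpen Ω) (hb : Bornology.IsBounded Ω) (hne : Ω.Nonempty) {F : Mat2}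
    {yj : ℕ → Plane → Plane} {Gj : ℕ → Plane → Mat2} {y : Plane → Plane} {ν : Plane → Measure Mat2}
    (hy : ∀ j, MemW1Infty Ω (yj j) (Gj j)) (hF : ∀ j, HasAffineBoundaryValues Ω F (yj j))
    (hyi : ∀ i, Integrable (fun x => y x i) (volume.restrict Ω))
    (hyy : ∀ i, WeakStarTendsto Ω (fun j x => yj j x i) fun x => y x i)
    (hG : ∃ C : ℝ, ∀ j, ∀ᵐ x ∂volume.restrict Ω, ∀ i k, |Gj j x i k| ≤ C)
    (hY : GeneratesYoungMeasure Ω Gj ν)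
    (hK : ∀ᵐ x ∂volume.restrict Ω, ∀ᵐ A ∂ν x, A ∈ twoWell δ) :
    ∃ Q ∈ SO2, ∃ t ∈ Icc (0 : ℝ) 1, (∀ᵐ x ∂volume.restrict Ω, ν x = simpleLaminate δ Q t) ∧
      F = t • (Q * wellOne δ) + (1 - t) • (Q * wellTwo δ) ∧
      ∀ᵐ x ∂volume.restrict Ω, y x = WithLp.toLp 2 (F *ᵥ x.ofLp) := by
  obtain ⟨hunit, hcol⟩ := first_column_rigidity hδ hΩ hb hne hy hF hY hK hG
  set Q : Mat2 := !![F 0 0, -F 1 0; F 1 0, F 0 0] with hQdef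
  have hQ : Q ∈ SO2 := by
    rw [Matrix.of_mem_specialOrthogonalGroup_fin_two_iff]
    exact ⟨rfl, rfl, by rw [neg_sq]; exact hunit⟩
  have hQcol : ∀ i, Q i 0 = F i 0 := fun i => by fin_cases i <;> rfl
  have hlam : ∀ᵐ x ∂volume.restrict Ω, ∃ t ∈ Icc (0 : ℝ) 1, ν x = simpleLaminate δ Q t := by
    filter_upwards [hcol, hK, hY.isProbabilityMeasure] with x hx hxK hp
    refine exists_eq_two_diracs ?_
    filter_upwards [hx, hxK] with A hA hAK
    exact eq_or_eq_of_mem_twoWell hAK hQ (hA.1.trans (hQcol 0).symm) (hA.2.trans (hQcol 1).symm)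
  -- the barycenters of the Young measure
  set h : Fin 2 → Fin 2 → Plane → ℝ := fun i k x => ∫ A, A i k ∂ν x with hh
  have hcont : ∀ i k : Fin 2, Continuous fun A : Mat2 => A i k := fun i k => by fun_prop
  have hbary : ∀ i k, WeakStarTendsto Ω (fun j x => Gj j x i k) (h i k) ∧
      Integrable (h i k) (volume.restrict Ω) := fun i k =>
    let H := hY.weakStarTendsto_of_continuous hδ hK hG (hcont i k)
    ⟨H.1, integrable_of_memLp_top hb H.2⟩
  have hident : ∀ i k, ∀ φ : Plane → ℝ, ContDiff ℝ ∞ φ → HasCompactSupport φ →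
      ∫ x in Ω, (y x i - (F *ᵥ x.ofLp) i) * fderiv ℝ φ x (EuclideanSpace.single k 1) =
        -∫ x in Ω, (h i k x - F i k) * φ x := fun i k φ hφ hc =>
    setIntegral_mul_fderiv_of_weakStarTendsto hΩ hb hy hF (hyi i) (hbary i k).2 (hyy i)
      (hbary i k).1 hφ hc
  have hh0 : ∀ i, ∀ᵐ x ∂volume.restrict Ω, h i 0 x - F i 0 = 0 := by
    intro i
    filter_upwards [hlam] with x ⟨t, ht, hx⟩
    rw [hh]
    simp only [hx, integral_apply_zero_simpleLaminate ht, hQcol, sub_self]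
  have hy0 : ∀ i, ∀ᵐ x ∂volume.restrict Ω, y x i - (F *ᵥ x.ofLp) i = 0 := by
    intro i
    refine ae_eq_zero_of_setIntegral_mul_fderiv_eq_zero hΩ hb
      ((hyi i).sub (integrable_of_memLp_top hb (Plane.memLp_mulVec hΩ hb F i)))
      (e := EuclideanSpace.single 0 1) (by simp) fun φ hφ hc => ?_
    rw [hident i 0 φ hφ hc, neg_eq_zero]
    refine integral_eq_zero_of_ae ?_
    filter_upwards [hh0 i] with x hx
    rw [hx, zero_mul, Pi.zero_apply]
  have hhF : ∀ i k, ∀ᵐ x ∂volume.restrict Ω, h i k x = F i k := by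
    intro i k
    have hconst : Integrable (fun _ => F i k) (volume.restrict Ω) :=
      integrable_of_memLp_top hb (memLp_top_const _)
    have key : ∀ᵐ x ∂volume.restrict Ω, h i k x - F i k = 0 := by
      refine ae_eq_of_forall_setIntegral_mul_eq hΩ ((hbary i k).2.sub hconst)
        (integrable_zero _ _ _) fun φ hφ hc _ => ?_
      simp only [zero_mul, integral_zero]
      rw [← neg_eq_zero, ← hident i k φ hφ hc]
      refine integral_eq_zero_of_ae ?_
      filter_upwards [hy0 i] with x hx
      rw [hx, zero_mul, Pi.zero_apply]
    exact key.mono fun x hx => sub_eq_zero.1 hx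
  have : (ae (volume.restrict Ω)).NeBot := by
    rw [ae_restrict_neBot]
    exact (hΩ.measure_pos volume hne).ne'
  have hgood : ∀ᵐ x ∂volume.restrict Ω, ∃ t ∈ Icc (0 : ℝ) 1, ν x = simpleLaminate δ Q t ∧
      ∀ i k, ∫ A, A i k ∂simpleLaminate δ Q t = F i k := by
    filter_upwards [hlam, ae_all_iff.2 fun i => ae_all_iff.2 (hhF i)] with x ⟨t, ht, hx⟩ hxF
    refine ⟨t, ht, hx, fun i k => ?_⟩
    rw [← hxF i k, ← hx]
  obtain ⟨x₀, t, ht, -, htF⟩ := hgood.exists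
  refine ⟨Q, hQ, t, ht, ?_, ?_, ?_⟩
  · filter_upwards [hgood] with x ⟨s, hs, hxs, hsF⟩
    rw [hxs]
    by_cases hδ0 : δ = 0
    · subst hδ0
      exact simpleLaminate_zero_congr hs ht
    · rw [eq_of_integral_simpleLaminate_eq hδ0 hQ hs ht fun i => by rw [hsF, htF]]
  · ext i k
    rw [← htF i k, integral_simpleLaminate ht]
    simp only [Matrix.add_apply, Matrix.smul_apply, smul_eq_mul]
  · filter_upwards [ae_all_iff.2 hy0] with x hx
    ext i
    exact sub_eq_zero.1 (hx i)

theorem ae_mem_of_support_subset {ν : Measure Mat2} {s : Set Mat2} (h : ν.support ⊆ s) :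
    ∀ᵐ A ∂ν, A ∈ s :=
  mem_of_superset Measure.support_mem_ae h

/-- An exact solution is treated as a constant sequence, which generates the Dirac masses at its
gradient. -/
theorem generatesYoungMeasure_dirac {Ω : Set Plane} {u : Plane → Plane} {G : Plane → Mat2}
    (hu : MemW1Infty Ω u G) :
    GeneratesYoungMeasure Ω (fun _ => G) fun x => Measure.dirac (G x) where
  isProbabilityMeasure := .of_forall fun x => inferInstance
  aemeasurable f := by
    simp only [integral_dirac]
    have hG : AEMeasurable (β := Fin 2 → Fin 2 → ℝ) G (volume.restrict Ω) :=
      aemeasurable_pi_lambda _ fun i => aemeasurable_pi_lambda _ fun k =>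
        (hu.memLp_grad i k).aestronglyMeasurable.aemeasurable
    have hf : Measurable (α := Fin 2 → Fin 2 → ℝ) f :=
      Continuous.measurable (α := Fin 2 → Fin 2 → ℝ) f.continuous
    exact hf.comp_aemeasurable hG
  tendsto f φ _ := by simpa only [integral_dirac] using tendsto_const_nhds

theorem mainTheorem2 (δ : ℝ) (hδ : δ ∈ Set.Ioo (-1 : ℝ) 1)
    (Ω : Set Plane) (hΩ_open : IsOpen Ω) (hΩ_bdd : Bornology.IsBounded Ω) (hΩ_ne : Ω.Nonempty) :
    -- the two wells have exactly one rank-one connection (up to a common rotation)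
    (δ ≠ 0 →
      (∀ Q ∈ SO2, (Q * wellOne δ - wellTwo δ).rank = 1 ↔ Q = 1) ∧
      (∀ Q ∈ SO2, (Q * wellOne δ - wellOne δ).rank ≠ 1) ∧
      (∀ Q ∈ SO2, (Q * wellTwo δ - wellTwo δ).rank ≠ 1)) ∧
    -- gradient Young measures with affine boundary data supported in `K` are simple laminates
    (∀ (F : Mat2) (yj : ℕ → Plane → Plane) (Gj : ℕ → Plane → Mat2)
      (y : Plane → Plane) (G : Plane → Mat2) (ν : Plane → Measure Mat2),
      (∀ j, MemW1Infty Ω (yj j) (Gj j)) →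
      (∀ j, HasAffineBoundaryValues Ω F (yj j)) →
      MemW1Infty Ω y G →
      WeakStarTendstoW1Infty Ω yj Gj y G →
      GeneratesYoungMeasure Ω Gj ν →
      (∀ᵐ x ∂volume.restrict Ω, (ν x).support ⊆ twoWell δ) →
      ∃ Q ∈ SO2, ∃ t ∈ Set.Icc (0 : ℝ) 1,
        (∀ᵐ x ∂volume.restrict Ω, ν x = simpleLaminate δ Q t) ∧
        F = t • (Q * wellOne δ) + (1 - t) • (Q * wellTwo δ) ∧
        (∀ Q' ∈ SO2, ∀ t' ∈ Set.Icc (0 : ℝ) 1,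
          (∀ᵐ x ∂volume.restrict Ω, ν x = simpleLaminate δ Q' t') →
            Q' = Q ∧ (δ ≠ 0 → t' = t))) ∧
    -- exact solutions of `∇u ∈ K` with affine boundary data are affine
    (∀ (F : Mat2) (u : Plane → Plane) (G : Plane → Mat2),
      MemW1Infty Ω u G →
      HasAffineBoundaryValues Ω F u →
      (∀ᵐ x ∂volume.restrict Ω, G x ∈ twoWell δ) →
      F ∈ twoWell δ ∧ ∀ᵐ x ∂volume.restrict Ω, u x = WithLp.toLp 2 (F *ᵥ x.ofLp)) := by
  refine ⟨fun hδ0 => ⟨fun Q hQ => rank_mul_wellOne_sub_wellTwo_eq_one_iff hδ0 hQ,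
    fun Q hQ => rank_mul_sub_self_ne_one hQ (det_wellOne_ne_zero hδ),
    fun Q hQ => rank_mul_sub_self_ne_one hQ (det_wellTwo_ne_zero hδ)⟩, ?_, ?_⟩
  · intro F yj Gj y G ν hyj hF hy hconv hY hsupp
    obtain ⟨C, hC⟩ := hconv.bounded
    obtain ⟨Q, hQ, t, ht, hν, hFt, -⟩ := twoWell_rigidity hδ hΩ_open hΩ_bdd hΩ_ne hyj hF
      (fun i => integrable_of_memLp_top hΩ_bdd (hy.memLp i)) hconv.tendsto
      ⟨C, fun j => (hC j).mono fun x hx => hx.2⟩ hY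
      (hsupp.mono fun x hx => ae_mem_of_support_subset hx)
    refine ⟨Q, hQ, t, ht, hν, hFt, fun Q' hQ' t' ht' hν' => ?_⟩
    have : (ae (volume.restrict Ω)).NeBot := by
      rw [ae_restrict_neBot]
      exact (hΩ_open.measure_pos volume hΩ_ne).ne'
    obtain ⟨x, hx, hx'⟩ := (hν.and hν').exists
    exact simpleLaminate_injective hQ' hQ ht' ht (hx'.symm.trans hx)
  · intro F u G hu hF hG
    obtain ⟨Q, -, t, ht, hν, hFt, hu'⟩ := twoWell_rigidity hδ hΩ_open hΩ_bdd hΩ_ne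
      (fun _ : ℕ => hu) (fun _ => hF) (fun i => integrable_of_memLp_top hΩ_bdd (hu.memLp i))
      (fun i φ _ => tendsto_const_nhds)
      ⟨2, fun _ => hG.mono fun x hx i k => abs_apply_le_of_mem_twoWell hδ hx i k⟩
      (generatesYoungMeasure_dirac hu) (hG.mono fun x hx => by rw [ae_dirac_eq]; exact hx)
    refine ⟨?_, hu'⟩
    have : (ae (volume.restrict Ω)).NeBot := by
      rw [ae_restrict_neBot]
      exact (hΩ_open.measure_pos volume hΩ_ne).ne'
    -- `F` is the barycenter of the laminate, which is the Dirac mass at a gradient in the wells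
    obtain ⟨x, hxG, hx⟩ := (hG.and hν).exists
    have hGF : G x = F := by
      ext i k
      have h1 : ∫ A, A i k ∂Measure.dirac (G x) = G x i k := integral_dirac _ _
      rw [← h1, hx, integral_simpleLaminate ht, hFt]
      simp only [Matrix.add_apply, Matrix.smul_apply, smul_eq_mul]
    rwa [← hGF]
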